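/- Let $(W,\mathcal S)$ be a finite Coxeter system with Coxeter matrix $(m(s,t))_{s,t\in\mathcal S}$ and Coxeter length $\ell$. Let $B(W)$ be its Artin group, that is, the group generated by (a formal copy of) $\mathcal S$ subject only to the braid relations $sts\cdots = tst\cdots$ ($m(s,t)$ letters on each side) for $s\ne t$ in $\mathcal S$, and let the positive Artin monoid $B^+=B^+(W)$ be the submonoid of $B(W)$ generated by $\mathcal S$. For $w\in B^+$ let $\ell(w)$ be the length of a shortest expression of $w$ as a product of elements of $\mathcal S$. The (right) weak order on $B^+$ is the partial order in which $u\le w$ if there is $v\in B^+$ with $uv=w$ and $\ell(u)+\ell(v)=\ell(w)$. Let $w_\circ\in W$ be the longest element, and write $w_\circ$ also for the element of $B^+$ represented by a reduced word of it. For $u=s_1s_2\cdots s_p\in B^+$ with all $s_i\in\mathcal S$, put $\mathrm{rev}(u)=s_p\cdots s_2s_1$. Then for every integer $m\ge 0$ the $m$-weak order, i.e. the interval $[e,w_\circ^m]$ in the weak order on $B^+$ (with $e$ the identity), is a finite lattice. It is graded by the length $\ell$, with $\ell(e)=0$ and $\ell(w_\circ^m)=m\,\ell(w_\circ)$. It is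 rank-symmetric: for all integers $k,l\ge 0$ with $k+l=m\,\ell(w_\circ)$, the number of elements of length $k$ in the interval equals the number of elements of length $l$. It is self-dual: for every $w\in[e,w_\circ^m]$ the element $w_\circ^m w^{-1}$ of $B(W)$ lies in $B^+$, and $w\mapsto \mathrm{rev}(w_\circ^m w^{-1})$ is an order-reversing bijection of $[e,w_\circ^m]$ onto itself whose inverse is also order-reversing. -/

import Mathlib

namespace Artin

variable {B W : Type*} [Group W]

/-- The braid relator attached to two generators `i, j`: the quotient of the two alternating words
in `i, j` of length `M i j`. It is trivial for `i = j`, and for `M i j = 0` (which encodes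
`m(i, j) = ∞`). -/
def braidRelator (M : CoxeterMatrix B) (i j : B) : FreeGroup B :=
  ((CoxeterSystem.braidWord M i j).map FreeGroup.of).prod *
    ((CoxeterSystem.braidWord M j i).map FreeGroup.of).prod⁻¹

/-- The Artin group of a Coxeter matrix: generators `B`, subject to the braid relations only. -/
abbrev ArtinGroup (M : CoxeterMatrix B) : Type _ :=
  PresentedGroup (Set.range fun p : B × B => braidRelator M p.1 p.2)

/-- The generators of the Artin group. -/
def gen (M : CoxeterMatrix B) (i : B) : ArtinGroup M := PresentedGroup.of i

/-- The positive Artin monoid: the submonoid of the Artin group generated by the generators. -/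
def positiveSubmonoid (M : CoxeterMatrix B) : Submonoid (ArtinGroup M) :=
  Submonoid.closure (Set.range (gen M))

/-- The positive Artin monoid as a type. -/
abbrev ArtinMonoid (M : CoxeterMatrix B) : Type _ := ↥(positiveSubmonoid M)

/-- The generators of the positive Artin monoid. -/
def posGen (M : CoxeterMatrix B) (i : B) : ArtinMonoid M :=
  ⟨gen M i, Submonoid.subset_closure ⟨i, rfl⟩⟩

/-- The element of the positive Artin monoid represented by a word in the generators. -/
def word (M : CoxeterMatrix B) (ω : List B) : ArtinMonoid M := (ω.map (posGen M)).prod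

theorem word_nil (M : CoxeterMatrix B) : word M [] = 1 := rfl

theorem word_append (M : CoxeterMatrix B) (ω ω' : List B) :
    word M (ω ++ ω') = word M ω * word M ω' := by
  simp [word]

theorem word_surjective (M : CoxeterMatrix B) : Function.Surjective (word M) := by
  rintro ⟨x, hx⟩
  suffices h : ∃ ω, (word M ω : ArtinGroup M) = x by
    obtain ⟨ω, h⟩ := h
    exact ⟨ω, Subtype.ext h⟩
  induction hx using Submonoid.closure_induction with
  | mem x hx =>
    obtain ⟨i, rfl⟩ := hx
    exact ⟨[i], by simp [word, posGen]⟩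
  | one => exact ⟨[], rfl⟩
  | mul x y _ _ hx hy =>
    obtain ⟨ω, rfl⟩ := hx
    obtain ⟨ω', rfl⟩ := hy
    exact ⟨ω ++ ω', by rw [word_append]; rfl⟩

/-- The length of an element of the positive Artin monoid: the length of a shortest expression as
a product of generators. -/
noncomputable def length {M : CoxeterMatrix B} (w : ArtinMonoid M) : ℕ :=
  sInf {n | ∃ ω : List B, ω.length = n ∧ word M ω = w}

theorem exists_word_length_eq {M : CoxeterMatrix B} (w : ArtinMonoid M) :
    ∃ ω : List B, ω.length = length w ∧ word M ω = w := by
  obtain ⟨ω, h⟩ := word_surjective M w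
  exact Nat.sInf_mem (s := {n | ∃ ω : List B, ω.length = n ∧ word M ω = w}) ⟨_, ω, rfl, h⟩

theorem length_word_le {M : CoxeterMatrix B} (ω : List B) : length (word M ω) ≤ ω.length :=
  Nat.sInf_le ⟨ω, rfl, rfl⟩

theorem length_one {M : CoxeterMatrix B} : length (1 : ArtinMonoid M) = 0 :=
  Nat.le_zero.1 (length_word_le (M := M) [])

theorem eq_one_of_length_eq_zero {M : CoxeterMatrix B} {w : ArtinMonoid M} (h : length w = 0) :
    w = 1 := by
  obtain ⟨ω, h1, rfl⟩ := exists_word_length_eq w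
  rw [h] at h1
  rw [List.eq_nil_of_length_eq_zero h1, word_nil]

theorem length_mul_le {M : CoxeterMatrix B} (u v : ArtinMonoid M) :
    length (u * v) ≤ length u + length v := by
  obtain ⟨ω, h1, h2⟩ := exists_word_length_eq u
  obtain ⟨ω', h1', h2'⟩ := exists_word_length_eq v
  rw [← h1, ← h1', ← List.length_append]
  conv_lhs => rw [← h2, ← h2', ← word_append]
  exact length_word_le _

/-- The (right) weak order on the positive Artin monoid: `u ≤ w` if `w = u v` for some `v` in the
monoid with `ℓ(u) + ℓ(v) = ℓ(w)`. -/
instance weakOrder (M : CoxeterMatrix B) : PartialOrder (ArtinMonoid M) where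
  le u w := ∃ v : ArtinMonoid M, u * v = w ∧ length u + length v = length w
  le_refl u := ⟨1, mul_one u, by rw [length_one, add_zero]⟩
  le_trans := by
    rintro u w x ⟨v, rfl, h⟩ ⟨v', rfl, h'⟩
    refine ⟨v * v', (mul_assoc _ _ _).symm, ?_⟩
    have h1 := length_mul_le v v'
    have h2 := length_mul_le u (v * v')
    rw [← mul_assoc] at h2
    omega
  le_antisymm := by
    rintro u w ⟨v, rfl, h⟩ ⟨v', _, h'⟩
    have hv : v = 1 := eq_one_of_length_eq_zero (by omega)
    rw [hv, mul_one]

theorem prod_map_braidWord_eq (M : CoxeterMatrix B) (i j : B) :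
    ((CoxeterSystem.braidWord M i j).map (gen M)).prod =
      ((CoxeterSystem.braidWord M j i).map (gen M)).prod := by
  have h : PresentedGroup.mk (Set.range fun p : B × B => braidRelator M p.1 p.2)
      (braidRelator M i j) = 1 :=
    PresentedGroup.one_of_mem ⟨(i, j), rfl⟩
  rw [braidRelator, map_mul, map_inv, mul_inv_eq_one, map_list_prod, map_list_prod,
    List.map_map, List.map_map] at h
  exact h

theorem reverse_alternatingWord (i j : B) (p : ℕ) :
    (CoxeterSystem.alternatingWord i j p).reverse =
      if Even p then CoxeterSystem.alternatingWord j i p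
      else CoxeterSystem.alternatingWord i j p := by
  induction p generalizing i j with
  | zero => simp [CoxeterSystem.alternatingWord]
  | succ p ih =>
    rw [CoxeterSystem.alternatingWord_succ, List.concat_eq_append, List.reverse_append, ih]
    rw [CoxeterSystem.alternatingWord_succ', ← List.concat_eq_append,
      ← CoxeterSystem.alternatingWord_succ, CoxeterSystem.alternatingWord_succ']
    by_cases h : Even p <;> simp [h, Nat.even_add_one]

theorem prod_map_op_gen (M : CoxeterMatrix B) (ω : List B) :
    (ω.map fun i => MulOpposite.op (gen M i)).prod =
      MulOpposite.op (ω.reverse.map (gen M)).prod := by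
  induction ω with
  | nil => simp
  | cons i ω ih => simp [ih]

theorem prod_map_reverse_braidWord_eq (M : CoxeterMatrix B) (i j : B) :
    ((CoxeterSystem.braidWord M i j).reverse.map (gen M)).prod =
      ((CoxeterSystem.braidWord M j i).reverse.map (gen M)).prod := by
  have h := prod_map_braidWord_eq M i j
  rw [CoxeterSystem.braidWord, CoxeterSystem.braidWord, M.symmetric j i] at h
  rw [CoxeterSystem.braidWord, CoxeterSystem.braidWord, M.symmetric j i,
    reverse_alternatingWord, reverse_alternatingWord]
  split_ifs
  · exact h.symm
  · exact h

/-- The anti-automorphism of the Artin group that fixes all the generators. -/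
def revHom (M : CoxeterMatrix B) : ArtinGroup M →* (ArtinGroup M)ᵐᵒᵖ :=
  PresentedGroup.toGroup (f := fun i => MulOpposite.op (gen M i)) (by
    rintro _ ⟨⟨i, j⟩, rfl⟩
    simp only [braidRelator, map_mul, map_inv, mul_inv_eq_one, map_list_prod, List.map_map]
    have h : (FreeGroup.lift fun i => MulOpposite.op (gen M i)) ∘ FreeGroup.of =
        fun i => MulOpposite.op (gen M i) := by
      funext k
      simp
    rw [h, prod_map_op_gen, prod_map_op_gen, prod_map_reverse_braidWord_eq])

theorem revHom_word (M : CoxeterMatrix B) (ω : List B) :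
    (revHom M (word M ω : ArtinGroup M)).unop = (word M ω.reverse : ArtinGroup M) := by
  induction ω with
  | nil => simp [word]
  | cons i ω ih =>
    have h1 : word M (i :: ω) = word M [i] * word M ω := word_append M [i] ω
    have h2 : (revHom M (word M [i] : ArtinGroup M)).unop = (word M [i] : ArtinGroup M) := by
      have : (word M [i] : ArtinGroup M) = PresentedGroup.of i := by simp [word, posGen, gen]
      rw [this, revHom, PresentedGroup.toGroup.of]
      rfl
    rw [h1, List.reverse_cons, word_append, Submonoid.coe_mul, map_mul, MulOpposite.unop_mul, ih,
      h2, Submonoid.coe_mul]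

/-- The reverse map on the positive Artin monoid, sending `s₁ s₂ ⋯ sₚ` to `sₚ ⋯ s₂ s₁`
(see `rev_word`). -/
def rev {M : CoxeterMatrix B} (w : ArtinMonoid M) : ArtinMonoid M :=
  ⟨(revHom M (w : ArtinGroup M)).unop, by
    obtain ⟨ω, rfl⟩ := word_surjective M w
    rw [revHom_word]
    exact (word M ω.reverse).2⟩

theorem rev_word (M : CoxeterMatrix B) (ω : List B) : rev (word M ω) = word M ω.reverse :=
  Subtype.ext (revHom_word M ω)

/-- The longest element `w∘` of a finite Coxeter group: an element of maximal Coxeter length. -/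
noncomputable def longestElement [Finite W] {M : CoxeterMatrix B} (cs : CoxeterSystem M W) : W :=
  (Finite.exists_max cs.length).choose

/-- The element of the positive Artin monoid represented by a reduced word of `w`. -/
noncomputable def posLift {M : CoxeterMatrix B} (cs : CoxeterSystem M W) (w : W) : ArtinMonoid M :=
  word M (cs.exists_isReduced w).choose

/-- The fundamental element: the longest element `w∘`, seen in the positive Artin monoid. -/
noncomputable def fundamental [Finite W] {M : CoxeterMatrix B} (cs : CoxeterSystem M W) :
    ArtinMonoid M :=
  posLift cs (longestElement cs)

/-- The `m`-weak order: the interval from `1` to `w∘ ^ m` in the weak order of the positive Artin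
monoid, with the induced order. -/
abbrev MWeak [Finite W] {M : CoxeterMatrix B} (cs : CoxeterSystem M W) (m : ℕ) : Type _ :=
  ↥(Set.Icc (1 : ArtinMonoid M) (fundamental cs ^ m))

end Artin

/-!
The geometric representation shows that lengths add in `W` when an element without descents `i` and
`j` is multiplied by an alternating word in `i` and `j`. This yields local least common multiples
for the weak order of `W`, hence Matsumoto's theorem, and makes the largest reduced left factor a
well-defined function on the monoid presented by the braid relations. Letting that monoid act on
pairs of a reduced factor and a remainder shows that it is left cancellative. For finite `W`, the
square of its fundamental element is central and a multiple of every generator, so inverting it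
produces a group; therefore the monoid embeds in the Artin group as the positive monoid `B⁺`.

In `B⁺` the length is a homomorphism, so the weak order is left divisibility, and greatest common
divisors exist by Newman's lemma. Finally `D = w∘ ^ m` is a palindrome with `B⁺ D ⊆ D B⁺`, so
`w ↦ rev (D w⁻¹)` reverses the order of `[1, D]`. This gives rank symmetry, and turns meets into
joins.
-/

namespace Artin

section GeometricRepresentation

open CoxeterSystem Finsupp

variable {B W : Type*} [Group W] {M : CoxeterMatrix B}

/-- The linear form on the geometric representation whose value at the simple root of `j` is twice
the canonical bilinear form at the simple roots of `i` and `j`. The convention `π / 0 = 0` gives the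
customary value `-2` when `M i j = 0`, that is, when `m(i, j) = ∞`. -/
noncomputable def simpleCoroot (M : CoxeterMatrix B) (i : B) : Module.Dual ℝ (B →₀ ℝ) :=
  Finsupp.lift ℝ ℝ B fun j => -(2 * Real.cos (Real.pi / M i j))

theorem simpleCoroot_single (i j : B) :
    simpleCoroot M i (single j 1) = -(2 * Real.cos (Real.pi / M i j)) := by
  simp [simpleCoroot]

theorem simpleCoroot_single_self (i : B) : simpleCoroot M i (single i 1) = 2 := by
  simp [simpleCoroot_single]

/-- The simple reflection attached to `i` in the geometric representation. -/
noncomputable def simpleReflection (M : CoxeterMatrix B) (i : B) : (B →₀ ℝ) ≃ₗ[ℝ] (B →₀ ℝ) :=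
  Module.reflection (simpleCoroot_single_self (M := M) i)

theorem simpleReflection_single_self (i : B) :
    simpleReflection M i (single i 1) = -single i 1 :=
  Module.reflection_apply_self _

theorem simpleReflection_smul_add_smul (i j : B) (x y : ℝ) :
    simpleReflection M i (x • single i 1 + y • single j 1) =
      (2 * Real.cos (Real.pi / M i j) * y - x) • single i 1 + y • single j 1 := by
  rw [simpleReflection, Module.reflection_apply, map_add, map_smul, map_smul,
    simpleCoroot_single_self, simpleCoroot_single, smul_eq_mul, smul_eq_mul]
  module

theorem sin_pi_div_pos {m : ℕ} (hm : 2 ≤ m) : 0 < Real.sin (Real.pi / m) := by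
  have h : (2 : ℝ) ≤ m := by exact_mod_cast hm
  apply Real.sin_pos_of_pos_of_lt_pi
  · have := Real.pi_pos; positivity
  · exact div_lt_self Real.pi_pos (by linarith)

open Polynomial.Chebyshev in
theorem eval_chebyshevS_two_mul_cos_pi_div {k : ℕ} (hk : 2 ≤ k) :
    (S ℝ (k - 1)).eval (2 * Real.cos (Real.pi / k)) = 0 := by
  have hk0 : (k : ℝ) ≠ 0 := by positivity
  refine (mul_eq_zero.1 ?_).resolve_right (sin_pi_div_pos hk).ne'
  rw [S_two_mul_real_cos]
  push_cast
  rw [sub_add_cancel, mul_div_cancel₀ _ hk0, Real.sin_pi]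

open Polynomial.Chebyshev in
theorem eval_chebyshevS_add_eval_chebyshevS_two_mul_cos {k : ℕ} (hk : 1 ≤ k) :
    (S ℝ k).eval (2 * Real.cos (2 * (Real.pi / (2 * k + 1 : ℕ)))) +
      (S ℝ (k - 1)).eval (2 * Real.cos (2 * (Real.pi / (2 * k + 1 : ℕ)))) = 0 := by
  set θ := Real.pi / (2 * k + 1 : ℕ) with hθ
  have hmθ : (2 * k + 1 : ℕ) * θ = Real.pi := by rw [hθ]; field_simp
  have hsin : 0 < Real.sin θ := sin_pi_div_pos (by omega)
  have hcos : 0 < Real.cos θ := by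
    have : (1 : ℝ) ≤ k := by exact_mod_cast hk
    push_cast at hmθ
    have hθ0 : 0 < θ := by positivity
    apply Real.cos_pos_of_mem_Ioo
    constructor <;> nlinarith
  have hsin2 : Real.sin (2 * θ) ≠ 0 := by rw [Real.sin_two_mul]; positivity
  refine (mul_eq_zero.1 ?_).resolve_right hsin2
  rw [add_mul, S_two_mul_real_cos, S_two_mul_real_cos]
  have hadd : ((k : ℤ) + 1 : ℝ) * (2 * θ) = Real.pi + θ := by
    rw [← hmθ]; push_cast; ring
  have hsub : (((k - 1 : ℤ) : ℝ) + 1) * (2 * θ) = Real.pi - θ := by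
    rw [← hmθ]; push_cast; ring
  rw [hadd, hsub, Real.sin_pi_sub, Real.sin_add, Real.sin_pi, Real.cos_pi]
  ring

theorem reflection_mul_reflection_pow_eq_one {V : Type*} [AddCommGroup V] [Module ℝ V] {x y : V}
    {f g : Module.Dual ℝ V} (hf : f x = 2) (hg : g y = 2) {m : ℕ} (hm : 2 ≤ m)
    (hfy : f y = -(2 * Real.cos (Real.pi / m))) (hgx : g x = -(2 * Real.cos (Real.pi / m))) :
    (Module.reflection hf * Module.reflection hg) ^ m = 1 := by
  ext z
  have ht : 2 * Real.cos (2 * (Real.pi / m)) = f y * g x - 2 := by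
    rw [hfy, hgx, Real.cos_two_mul]; ring
  change _ = z
  obtain rfl | hlt := hm.eq_or_lt
  · have hfy0 : f y = 0 := by simp [hfy]
    have hgx0 : g x = 0 := by simp [hgx]
    simp only [pow_two, LinearEquiv.mul_apply, Module.reflection_apply, map_sub, map_smul, hf,
      hg, hfy0, hgx0]
    module
  rw [Module.reflection_mul_reflection_pow_apply hf hg m z _ ht]
  obtain ⟨k, rfl | rfl⟩ := m.even_or_odd'
  · have hS := eval_chebyshevS_two_mul_cos_pi_div (k := k) (by omega)
    have hangle : 2 * (Real.pi / (2 * k : ℕ)) = Real.pi / k := by push_cast; field_simp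
    rw [show (((2 * k : ℕ) : ℤ) - 2) / 2 = k - 1 by omega,
      show (((2 * k : ℕ) : ℤ) - 1) / 2 = k - 1 by omega, hangle, hS]
    simp
  · have hS := eval_chebyshevS_add_eval_chebyshevS_two_mul_cos (k := k) (by omega)
    rw [show (((2 * k + 1 : ℕ) : ℤ) - 1) / 2 = k by omega,
      show (((2 * k + 1 : ℕ) : ℤ) - 2) / 2 = k - 1 by omega,
      show (((2 * k + 1 : ℕ) : ℤ) - 3) / 2 = k - 1 by omega,
      show ((2 * k + 1 : ℕ) : ℤ) / 2 = k by omega, hS]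
    simp

theorem simpleReflection_mul_pow_eq_one (i j : B) :
    (simpleReflection M i * simpleReflection M j) ^ M i j = 1 := by
  by_cases hij : i = j
  · subst hij
    rw [M.diagonal, pow_one]
    exact mul_eq_one_iff_eq_inv.2 (Module.reflection_inv _).symm
  by_cases hM : M i j = 0
  · rw [hM, pow_zero]
  have := M.off_diagonal i j hij
  exact reflection_mul_reflection_pow_eq_one _ _ (by omega) (simpleCoroot_single i j)
    (by rw [simpleCoroot_single, M.symmetric])

variable (cs : CoxeterSystem M W)

/-- The geometric representation of a Coxeter group, on the space spanned by the simple roots. -/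
noncomputable def geometricRep : W →* ((B →₀ ℝ) ≃ₗ[ℝ] (B →₀ ℝ)) :=
  cs.lift ⟨simpleReflection M, simpleReflection_mul_pow_eq_one⟩

theorem geometricRep_simple (i : B) : geometricRep cs (cs.simple i) = simpleReflection M i :=
  cs.lift_apply_simple simpleReflection_mul_pow_eq_one i

open Polynomial.Chebyshev in
theorem eval_chebyshevS_two_mul_cos_pi_div_nonneg {m : ℕ} (hm : m ≠ 1) {n : ℤ} (hn : -1 ≤ n)
    (hnm : m = 0 ∨ n < m) : 0 ≤ (S ℝ n).eval (2 * Real.cos (Real.pi / m)) := by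
  have hn' : (0 : ℝ) ≤ n + 1 := by exact_mod_cast neg_le_iff_add_nonneg.1 hn
  rcases m.eq_zero_or_pos with rfl | hpos
  · simpa [S_eval_two] using hn'
  · refine nonneg_of_mul_nonneg_left ?_ (sin_pi_div_pos (m := m) (by omega))
    rw [S_two_mul_real_cos]
    have hm' : (0 : ℝ) < m := by exact_mod_cast hpos
    have hnm' : (n : ℝ) + 1 ≤ m := by exact_mod_cast hnm.resolve_left hpos.ne'
    have := Real.pi_pos
    refine Real.sin_nonneg_of_nonneg_of_le_pi (by positivity) ?_
    rw [mul_div_assoc', div_le_iff₀ hm', mul_comm]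
    gcongr

open Polynomial.Chebyshev in
theorem geometricRep_wordProd_alternatingWord (i j : B) (k : ℕ) :
    geometricRep cs (cs.wordProd (alternatingWord i j k)) (single i 1) =
      (S ℝ (if Even k then k else k - 1)).eval (2 * Real.cos (Real.pi / M i j)) • single i 1 +
        (S ℝ (if Even k then k - 1 else k)).eval (2 * Real.cos (Real.pi / M i j)) •
          single j 1 := by
  set c := 2 * Real.cos (Real.pi / M i j) with hc
  have hS (n : ℕ) : (S ℝ (n + 1 : ℕ)).eval c = c * (S ℝ n).eval c - (S ℝ (n - 1)).eval c := by
    have := S_add_two ℝ (n - 1)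
    rw [sub_add_cancel, show (n - 1 + 2 : ℤ) = (n + 1 : ℕ) by push_cast; ring] at this
    rw [this, Polynomial.eval_sub, Polynomial.eval_mul, Polynomial.eval_X]
  have hcast (n : ℕ) : ((n + 1 : ℕ) : ℤ) - 1 = n := by push_cast; ring
  induction k with
  | zero => simp [alternatingWord]
  | succ k ih =>
    rw [alternatingWord_succ', wordProd_cons, map_mul, LinearEquiv.mul_apply, ih,
      geometricRep_simple]
    by_cases hk : Even k
    · simp only [hk, Nat.even_add_one, not_true, if_true, if_false]
      rw [add_comm, simpleReflection_smul_add_smul, add_comm, M.symmetric j i, ← hc, hS, hcast]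
    · simp only [hk, Nat.even_add_one, not_false_eq_true, if_true, if_false]
      rw [simpleReflection_smul_add_smul, ← hc, hS, hcast]

theorem exists_eq_mul_wordProd_alternatingWord {i : B} (j : B) {w : W}
    (hi : ¬ cs.IsRightDescent w i) :
    ∃ (y : W) (k : ℕ), w = y * cs.wordProd (alternatingWord i j k) ∧
      cs.length w = cs.length y + k ∧ ¬ cs.IsRightDescent y i ∧ ¬ cs.IsRightDescent y j := by
  induction hn : cs.length w using Nat.strong_induction_on generalizing w i j with
  | _ n ih =>
    by_cases hj : cs.IsRightDescent w j
    · obtain ⟨y, k, hw, hlen, hyj, hyi⟩ := ih _ (hn ▸ hj) i (w := w * cs.simple j)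
        (cs.isRightDescent_iff_not_isRightDescent_mul.1 hj) rfl
      refine ⟨y, k + 1, ?_, ?_, hyi, hyj⟩
      · rw [alternatingWord_succ, wordProd_concat, ← mul_assoc, ← hw,
          simple_mul_simple_cancel_right]
      · rw [isRightDescent_iff] at hj
        omega
    · exact ⟨w, 0, by simp [alternatingWord], by omega, hi, hj⟩

theorem le_of_length_mul_wordProd_alternatingWord {i j : B} {y : W} {k : ℕ}
    (h : cs.length (y * cs.wordProd (alternatingWord i j k)) = cs.length y + k) :
    M i j = 0 ∨ k ≤ M i j := by
  by_contra! hk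
  have hnot := cs.not_isReduced_alternatingWord i j hk.1 hk.2
  have hword := cs.length_wordProd_le (alternatingWord i j k)
  have hmul := cs.length_mul_le y (cs.wordProd (alternatingWord i j k))
  rw [CoxeterSystem.IsReduced] at hnot
  rw [length_alternatingWord] at hnot hword
  omega

theorem geometricRep_mul_wordProd_alternatingWord_nonneg {i j : B} (hij : i ≠ j) {y : W} {k : ℕ}
    (hk : M i j = 0 ∨ k < M i j) (hi : 0 ≤ geometricRep cs y (single i 1))
    (hj : 0 ≤ geometricRep cs y (single j 1)) :
    0 ≤ geometricRep cs (y * cs.wordProd (alternatingWord i j k)) (single i 1) := by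
  rw [map_mul, LinearEquiv.mul_apply, geometricRep_wordProd_alternatingWord, map_add, map_smul,
    map_smul]
  have hm := M.off_diagonal i j hij
  refine add_nonneg
    (smul_nonneg (eval_chebyshevS_two_mul_cos_pi_div_nonneg hm ?_ ?_) hi)
    (smul_nonneg (eval_chebyshevS_two_mul_cos_pi_div_nonneg hm ?_ ?_) hj) <;>
  split_ifs <;> omega

theorem geometricRep_single_nonneg {w : W} {i : B} (hi : ¬ cs.IsRightDescent w i) :
    0 ≤ geometricRep cs w (single i 1) := by
  induction hn : cs.length w using Nat.strong_induction_on generalizing w i with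
  | _ n ih =>
    rcases eq_or_ne w 1 with rfl | hw
    · simp
    obtain ⟨j, hj⟩ := cs.exists_rightDescent_of_ne_one hw
    have hij : i ≠ j := by
      rintro rfl
      exact hi hj
    obtain ⟨y, k, hy, hlen, hyi, hyj⟩ := exists_eq_mul_wordProd_alternatingWord cs j hi
    have hk : k ≠ 0 := by
      rintro rfl
      rw [alternatingWord, wordProd_nil, mul_one] at hy
      exact hyj (hy ▸ hj)
    have hkM : M i j = 0 ∨ k < M i j := by
      rw [M.symmetric i j]
      refine le_of_length_mul_wordProd_alternatingWord cs (y := y) ?_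
      rw [alternatingWord_succ, wordProd_concat, ← mul_assoc, ← hy]
      rw [not_isRightDescent_iff] at hi
      omega
    rw [hy]
    exact geometricRep_mul_wordProd_alternatingWord_nonneg cs hij hkM
      (ih _ (by omega) hyi rfl) (ih _ (by omega) hyj rfl)

theorem not_isRightDescent_of_geometricRep_single_nonneg {w : W} {i : B}
    (h : 0 ≤ geometricRep cs w (single i 1)) : ¬ cs.IsRightDescent w i := by
  intro hd
  have hneg := geometricRep_single_nonneg cs (cs.isRightDescent_iff_not_isRightDescent_mul.1 hd)
  rw [map_mul, LinearEquiv.mul_apply, geometricRep_simple, simpleReflection_single_self, map_neg,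
    neg_nonneg] at hneg
  have hzero := (LinearEquiv.map_eq_zero_iff _).1 (le_antisymm hneg h)
  simp at hzero

theorem length_mul_wordProd_alternatingWord {i j : B} (hij : i ≠ j) {y : W}
    (hi : ¬ cs.IsRightDescent y i) (hj : ¬ cs.IsRightDescent y j) {k : ℕ}
    (hk : M i j = 0 ∨ k ≤ M i j) :
    cs.length (y * cs.wordProd (alternatingWord i j k)) = cs.length y + k := by
  induction k generalizing i j with
  | zero => simp [alternatingWord]
  | succ k ih =>
    rw [M.symmetric i j] at hk
    have hdescent := not_isRightDescent_of_geometricRep_single_nonneg cs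
      (geometricRep_mul_wordProd_alternatingWord_nonneg cs hij.symm hk
        (geometricRep_single_nonneg cs hj) (geometricRep_single_nonneg cs hi))
    rw [not_isRightDescent_iff, ih hij.symm hj hi (by omega)] at hdescent
    rw [alternatingWord_succ, wordProd_concat, ← mul_assoc, hdescent, add_assoc]

theorem simple_injective : Function.Injective cs.simple := by
  intro i j h
  by_contra hij
  have hM := M.off_diagonal i j hij
  have hlen := length_mul_wordProd_alternatingWord cs hij (cs.not_isRightDescent_one i)
    (cs.not_isRightDescent_one j) (k := 2) (by omega)
  simp [alternatingWord, wordProd_cons, h] at hlen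

theorem exists_eq_mul_wordProd_braidWord {i j : B} (hij : i ≠ j) {u : W}
    (hi : cs.IsRightDescent u i) (hj : cs.IsRightDescent u j) :
    M i j ≠ 0 ∧ ∃ y, u = y * cs.wordProd (braidWord M i j) ∧ cs.length u = cs.length y + M i j := by
  obtain ⟨y, k, hy, hlen, hyj, hyi⟩ := exists_eq_mul_wordProd_alternatingWord cs i
    (cs.isRightDescent_iff_not_isRightDescent_mul.1 hj)
  have hu : u = y * cs.wordProd (alternatingWord i j (k + 1)) := by
    rw [alternatingWord_succ, wordProd_concat, ← mul_assoc, ← hy, simple_mul_simple_cancel_right]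
  have hulen : cs.length u = cs.length y + (k + 1) := by
    rw [isRightDescent_iff] at hj
    omega
  have hle := le_of_length_mul_wordProd_alternatingWord cs (y := y) (hu ▸ hulen)
  have hk : M i j = k + 1 := by
    by_contra hne
    have hlonger := length_mul_wordProd_alternatingWord cs hij.symm hyj hyi (k := k + 2)
      (by rw [M.symmetric j i]; omega)
    rw [alternatingWord_succ, wordProd_concat, ← mul_assoc, ← hu] at hlonger
    rw [isRightDescent_iff] at hi
    omega
  exact ⟨by omega, y, by rw [braidWord, hk, ← hu], by rw [hulen, hk]⟩

end GeometricRepresentation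

open Relation in
/-- Newman's lemma. -/
theorem exists_reflTransGen_greatest {α : Type*} {step : α → α → Prop}
    (hwf : WellFounded (flip step))
    (hconf : ∀ x y z, step x y → step x z → ∃ u, ReflTransGen step y u ∧ ReflTransGen step z u)
    (x : α) : ∃ g, ReflTransGen step x g ∧ ∀ y, ReflTransGen step x y → ReflTransGen step y g := by
  induction x using hwf.induction with
  | _ x ih =>
    by_cases hx : ∃ a, step x a
    · obtain ⟨a, hxa⟩ := hx
      obtain ⟨g, hag, hg⟩ := ih a hxa
      refine ⟨g, .head hxa hag, fun y hxy => ?_⟩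
      rcases hxy.cases_head with rfl | ⟨b, hxb, hby⟩
      · exact .head hxa hag
      · obtain ⟨u, hau, hbu⟩ := hconf x a b hxa hxb
        obtain ⟨g', -, hg'⟩ := ih b hxb
        exact (hg' y hby).trans (hg g' (hau.trans (hg' u hbu)))
    · refine ⟨x, .refl, fun y hxy => ?_⟩
      rcases hxy.cases_head with rfl | ⟨b, hxb, -⟩
      · exact .refl
      · exact absurd ⟨b, hxb⟩ hx

section ReducedProducts

open CoxeterSystem

variable {B W : Type*} [Group W] {M : CoxeterMatrix B}

/-- The product `x * y` in a Coxeter group is reduced, that is, the lengths of the factors add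
up. -/
def IsReducedMul (cs : CoxeterSystem M W) (x y : W) : Prop :=
  cs.length (x * y) = cs.length x + cs.length y

/-- The right weak order of a Coxeter group: `w` has a reduced factorization that starts
with `v`. -/
def WeakLE (cs : CoxeterSystem M W) (v w : W) : Prop :=
  ∃ a, v * a = w ∧ IsReducedMul cs v a

variable {cs : CoxeterSystem M W}

theorem IsReducedMul.left_of_mul {x y z : W} (h : IsReducedMul cs x (y * z))
    (h' : IsReducedMul cs y z) : IsReducedMul cs x y := by
  rw [IsReducedMul] at *
  have hxyz := cs.length_mul_le (x * y) z
  have hxy := cs.length_mul_le x y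
  rw [mul_assoc] at hxyz
  omega

theorem IsReducedMul.mul_left {x y z : W} (h : IsReducedMul cs x (y * z))
    (h' : IsReducedMul cs y z) : IsReducedMul cs (x * y) z := by
  have hxy := h.left_of_mul h'
  rw [IsReducedMul] at *
  rw [mul_assoc]
  omega

theorem IsReducedMul.right_of_mul {x y z : W} (h : IsReducedMul cs (x * y) z)
    (h' : IsReducedMul cs x y) : IsReducedMul cs y z := by
  rw [IsReducedMul] at *
  have hxyz := cs.length_mul_le x (y * z)
  have hyz := cs.length_mul_le y z
  rw [← mul_assoc] at hxyz
  omega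

theorem IsReducedMul.mul_right {x y z : W} (h : IsReducedMul cs (x * y) z)
    (h' : IsReducedMul cs x y) : IsReducedMul cs x (y * z) := by
  have hyz := h.right_of_mul h'
  rw [IsReducedMul] at *
  rw [← mul_assoc]
  omega

variable (cs)

theorem isReducedMul_one_left (x : W) : IsReducedMul cs 1 x := by simp [IsReducedMul]

theorem isReducedMul_one_right (x : W) : IsReducedMul cs x 1 := by simp [IsReducedMul]

theorem isReducedMul_simple_right_iff {x : W} {i : B} :
    IsReducedMul cs x (cs.simple i) ↔ ¬ cs.IsRightDescent x i := by
  rw [IsReducedMul, length_simple, not_isRightDescent_iff]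

theorem isReducedMul_simple_left_iff {x : W} {i : B} :
    IsReducedMul cs (cs.simple i) x ↔ ¬ cs.IsLeftDescent x i := by
  rw [IsReducedMul, length_simple, not_isLeftDescent_iff, add_comm]

theorem isReducedMul_simple_simple_mul_iff {x : W} {i : B} :
    IsReducedMul cs (cs.simple i) (cs.simple i * x) ↔ cs.IsLeftDescent x i := by
  rw [isReducedMul_simple_left_iff, ← isLeftDescent_iff_not_isLeftDescent_mul]

theorem weakLE_refl (v : W) : WeakLE cs v v := ⟨1, mul_one v, isReducedMul_one_right cs v⟩

theorem one_weakLE (w : W) : WeakLE cs 1 w := ⟨w, one_mul w, isReducedMul_one_left cs w⟩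

variable {cs}

theorem WeakLE.trans {u v w : W} (huv : WeakLE cs u v) (hvw : WeakLE cs v w) : WeakLE cs u w := by
  obtain ⟨a, rfl, ha⟩ := huv
  obtain ⟨b, rfl, hb⟩ := hvw
  exact ⟨a * b, (mul_assoc _ _ _).symm, hb.mul_right ha⟩

theorem WeakLE.length_le {v w : W} (h : WeakLE cs v w) : cs.length v ≤ cs.length w := by
  obtain ⟨a, rfl, ha⟩ := h
  rw [ha]
  exact Nat.le_add_right _ _

theorem WeakLE.eq_of_length_le {v w : W} (h : WeakLE cs v w) (hlen : cs.length w ≤ cs.length v) :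
    v = w := by
  obtain ⟨a, rfl, ha⟩ := h
  rw [ha] at hlen
  rw [cs.length_eq_zero_iff.1 (by omega : cs.length a = 0), mul_one]

theorem WeakLE.antisymm {v w : W} (hvw : WeakLE cs v w) (hwv : WeakLE cs w v) : v = w :=
  hvw.eq_of_length_le hwv.length_le

theorem IsReducedMul.weakLE {v a : W} (h : IsReducedMul cs v a) : WeakLE cs v (v * a) :=
  ⟨a, rfl, h⟩

theorem IsReducedMul.of_weakLE {x v w : W} (h : IsReducedMul cs x w) (hvw : WeakLE cs v w) :
    IsReducedMul cs x v := by
  obtain ⟨a, rfl, ha⟩ := hvw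
  exact h.left_of_mul ha

variable (cs)

theorem isReduced_braidWord {i j : B} (hij : i ≠ j) : cs.IsReduced (braidWord M i j) := by
  have hlen := length_mul_wordProd_alternatingWord cs hij (cs.not_isRightDescent_one i)
    (cs.not_isRightDescent_one j) (Or.inr le_rfl)
  rw [one_mul, cs.length_one, zero_add] at hlen
  rw [CoxeterSystem.IsReduced, braidWord, hlen, length_alternatingWord]

theorem isReducedMul_wordProd_braidWord {i j : B} (hij : i ≠ j) {x : W}
    (hi : IsReducedMul cs x (cs.simple i)) (hj : IsReducedMul cs x (cs.simple j)) :
    IsReducedMul cs x (cs.wordProd (braidWord M i j)) := by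
  rw [isReducedMul_simple_right_iff] at hi hj
  rw [IsReducedMul, isReduced_braidWord cs hij, length_alternatingWord]
  exact length_mul_wordProd_alternatingWord cs hij hi hj (Or.inr le_rfl)

theorem wordProd_braidWord_inv (i j : B) :
    (cs.wordProd (braidWord M i j))⁻¹ = cs.wordProd (braidWord M i j) := by
  rw [← wordProd_reverse, braidWord, reverse_alternatingWord]
  split_ifs
  · rw [← braidWord, ← wordProd_braidWord_eq, braidWord, M.symmetric j i]
  · rfl

theorem wordProd_braidWord_weakLE_of_isLeftDescent {i j : B} (hij : i ≠ j) {u : W}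
    (hi : cs.IsLeftDescent u i) (hj : cs.IsLeftDescent u j) :
    M i j ≠ 0 ∧ WeakLE cs (cs.wordProd (braidWord M i j)) u := by
  rw [← isRightDescent_inv_iff] at hi hj
  obtain ⟨hM, y, hu, hlen⟩ := exists_eq_mul_wordProd_braidWord cs hij hi hj
  have hu' : cs.wordProd (braidWord M i j) * y⁻¹ = u := by
    rw [← wordProd_braidWord_inv, ← mul_inv_rev, ← hu, inv_inv]
  refine ⟨hM, y⁻¹, hu', ?_⟩
  rw [IsReducedMul, hu', isReduced_braidWord cs hij, length_alternatingWord, cs.length_inv,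
    ← cs.length_inv, hlen, add_comm]

theorem exists_braidWord_eq_cons {i j : B} (hM : M i j ≠ 0) :
    ∃ ω, braidWord M i j = i :: ω ∨ braidWord M j i = i :: ω := by
  obtain ⟨m, hm⟩ := Nat.exists_eq_succ_of_ne_zero hM
  rw [braidWord, braidWord, M.symmetric j i, hm, Nat.succ_eq_add_one, alternatingWord_succ',
    alternatingWord_succ']
  by_cases hpar : Even m
  · exact ⟨alternatingWord j i m, .inr (by rw [if_pos hpar])⟩
  · exact ⟨alternatingWord i j m, .inl (by rw [if_neg hpar])⟩

theorem simple_weakLE_wordProd_of_isReduced_cons {i : B} {ω : List B}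
    (h : cs.IsReduced (i :: ω)) : WeakLE cs (cs.simple i) (cs.wordProd (i :: ω)) := by
  have hω : cs.IsReduced ω := h.drop 1
  refine ⟨cs.wordProd ω, (cs.wordProd_cons i ω).symm, ?_⟩
  rw [IsReducedMul, ← wordProd_cons, h, hω, length_simple, List.length_cons, add_comm]

theorem simple_weakLE_wordProd_braidWord {i j : B} (hij : i ≠ j) (hM : M i j ≠ 0) :
    WeakLE cs (cs.simple i) (cs.wordProd (braidWord M i j)) := by
  obtain ⟨ω, hω | hω⟩ := exists_braidWord_eq_cons hM
  · have hred := isReduced_braidWord cs hij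
    rw [hω] at hred ⊢
    exact simple_weakLE_wordProd_of_isReduced_cons cs hred
  · have hred := isReduced_braidWord cs hij.symm
    rw [wordProd_braidWord_eq]
    rw [hω] at hred ⊢
    exact simple_weakLE_wordProd_of_isReduced_cons cs hred

variable {cs}

theorem IsReducedMul.mul_weakLE_mul {x v w : W} (hx : IsReducedMul cs x w)
    (hvw : WeakLE cs v w) : WeakLE cs (x * v) (x * w) := by
  obtain ⟨a, rfl, ha⟩ := hvw
  exact ⟨a, mul_assoc x v a, hx.mul_left ha⟩

theorem IsReducedMul.weakLE_of_mul_weakLE_mul {x v w : W} (hxv : IsReducedMul cs x v)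
    (h : WeakLE cs (x * v) (x * w)) : WeakLE cs v w := by
  obtain ⟨a, ha, hred⟩ := h
  rw [mul_assoc] at ha
  exact ⟨a, mul_left_cancel ha, hred.right_of_mul hxv⟩

theorem WeakLE.mul_wordProd_braidWord {i j : B} (hij : i ≠ j) {v w : W}
    (hi : WeakLE cs (v * cs.simple i) w) (hvi : IsReducedMul cs v (cs.simple i))
    (hj : WeakLE cs (v * cs.simple j) w) (hvj : IsReducedMul cs v (cs.simple j)) :
    M i j ≠ 0 ∧ WeakLE cs (v * cs.wordProd (braidWord M i j)) w := by
  obtain ⟨a, ha, hva⟩ := hi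
  obtain ⟨b, hb, hvb⟩ := hj
  have hab : cs.simple i * a = cs.simple j * b := by
    rw [mul_assoc] at ha hb
    exact mul_left_cancel (ha.trans hb.symm)
  have hia := hva.right_of_mul hvi
  have hjb := hvb.right_of_mul hvj
  obtain ⟨hM, hle⟩ := wordProd_braidWord_weakLE_of_isLeftDescent cs hij
    (u := cs.simple i * a)
    ((isReducedMul_simple_simple_mul_iff cs).1 (by simpa using hia))
    ((isReducedMul_simple_simple_mul_iff cs).1 (by rw [hab]; simpa using hjb))
  refine ⟨hM, ?_⟩
  rw [← ha, mul_assoc]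
  exact (hva.mul_right hvi).mul_weakLE_mul hle

variable (cs)

/-- The covering steps of the right weak order that end in a given set. -/
def WeakStep (E : Set W) (v w : W) : Prop :=
  w ∈ E ∧ ∃ i, IsReducedMul cs v (cs.simple i) ∧ v * cs.simple i = w

theorem wellFounded_flip_weakStep {E : Set W} {N : ℕ} (hN : ∀ v ∈ E, cs.length v ≤ N) :
    WellFounded (flip (WeakStep cs E)) := by
  refine Subrelation.wf (r := InvImage (· < ·) fun v => N - cs.length v) ?_
    (InvImage.wf _ wellFounded_lt)
  rintro _ v ⟨hE, i, hi, rfl⟩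
  have hlen := hN _ hE
  rw [IsReducedMul, length_simple] at hi
  change N - cs.length (v * cs.simple i) < N - cs.length v
  omega

open Relation in
theorem reflTransGen_weakStep_iff {E : Set W} (hE : ∀ v w, WeakLE cs v w → w ∈ E → v ∈ E)
    {v w : W} (hw : w ∈ E) : ReflTransGen (WeakStep cs E) v w ↔ WeakLE cs v w := by
  constructor
  · intro h
    clear hw
    induction h with
    | refl => exact weakLE_refl cs v
    | tail _ hstep ih =>
      obtain ⟨-, i, hi, rfl⟩ := hstep
      exact ih.trans hi.weakLE
  · rintro ⟨a, rfl, ha⟩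
    induction hn : cs.length a generalizing a with
    | zero => rw [cs.length_eq_zero_iff.1 hn, mul_one]
    | succ n ih =>
      obtain ⟨i, hi⟩ := cs.exists_rightDescent_of_ne_one (w := a) (by rintro rfl; simp at hn)
      obtain ⟨a', rfl⟩ : ∃ a', a' * cs.simple i = a :=
        ⟨a * cs.simple i, simple_mul_simple_cancel_right cs i⟩
      rw [isRightDescent_iff_not_isRightDescent_mul, simple_mul_simple_cancel_right,
        ← isReducedMul_simple_right_iff] at hi
      have hva := ha.left_of_mul hi
      have hlast : WeakStep cs E (v * a') (v * (a' * cs.simple i)) :=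
        ⟨hw, i, ha.mul_left hi, mul_assoc _ _ _⟩
      have hmem : v * a' ∈ E := hE _ _ (ha.mul_weakLE_mul hi.weakLE) hw
      refine (ih a' hva hmem ?_).tail hlast
      rw [hi, length_simple] at hn
      omega

open Relation in
theorem exists_weakLE_greatest {E : Set W} (hone : 1 ∈ E)
    (hlower : ∀ v w, WeakLE cs v w → w ∈ E → v ∈ E) {N : ℕ} (hN : ∀ v ∈ E, cs.length v ≤ N)
    (hjoin : ∀ v i j, i ≠ j → IsReducedMul cs v (cs.simple i) → v * cs.simple i ∈ E →
      IsReducedMul cs v (cs.simple j) → v * cs.simple j ∈ E →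
      M i j ≠ 0 ∧ v * cs.wordProd (braidWord M i j) ∈ E) :
    ∃ g ∈ E, ∀ v ∈ E, WeakLE cs v g := by
  have hconf (v x y : W) (hx : WeakStep cs E v x) (hy : WeakStep cs E v y) :
      ∃ u, ReflTransGen (WeakStep cs E) x u ∧ ReflTransGen (WeakStep cs E) y u := by
    obtain ⟨hxE, i, hi, rfl⟩ := hx
    obtain ⟨hyE, j, hj, rfl⟩ := hy
    by_cases hij : i = j
    · subst hij
      exact ⟨_, .refl, .refl⟩
    obtain ⟨hM, hE⟩ := hjoin v i j hij hi hxE hj hyE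
    have hred := isReducedMul_wordProd_braidWord cs hij hi hj
    refine ⟨_, (reflTransGen_weakStep_iff cs hlower hE).2 (hred.mul_weakLE_mul
      (simple_weakLE_wordProd_braidWord cs hij hM)), (reflTransGen_weakStep_iff cs hlower hE).2
      (hred.mul_weakLE_mul ?_)⟩
    rw [wordProd_braidWord_eq]
    exact simple_weakLE_wordProd_braidWord cs (Ne.symm hij) (by rwa [M.symmetric])
  obtain ⟨g, hg, hmax⟩ :=
    exists_reflTransGen_greatest (wellFounded_flip_weakStep cs hN) hconf 1
  have hgE : g ∈ E := by
    rcases hg.cases_tail with h | ⟨_, -, h, -⟩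
    exacts [h ▸ hone, h]
  exact ⟨g, hgE, fun v hv => (reflTransGen_weakStep_iff cs hlower hgE).1
    (hmax v ((reflTransGen_weakStep_iff cs hlower hv).2 (one_weakLE cs v)))⟩

theorem exists_weakLE_greatest_isReducedMul (x w : W) :
    ∃ g, (WeakLE cs g w ∧ IsReducedMul cs x g) ∧
      ∀ v, WeakLE cs v w ∧ IsReducedMul cs x v → WeakLE cs v g := by
  refine exists_weakLE_greatest cs (E := {v | WeakLE cs v w ∧ IsReducedMul cs x v})
    ⟨one_weakLE cs w, isReducedMul_one_right cs x⟩
    (fun u v huv hv => ⟨huv.trans hv.1, hv.2.of_weakLE huv⟩) (fun v hv => hv.1.length_le) ?_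
  rintro v i j hij hi ⟨hiw, hxi⟩ hj ⟨hjw, hxj⟩
  obtain ⟨hM, hle⟩ := hiw.mul_wordProd_braidWord hij hi hjw hj
  refine ⟨hM, hle, IsReducedMul.mul_right ?_ (hxi.left_of_mul hi)⟩
  exact isReducedMul_wordProd_braidWord cs hij (hxi.mul_left hi) (hxj.mul_left hj)

theorem coxeterMatrix_apply_ne_zero [Finite W] (cs : CoxeterSystem M W) (i j : B) : M i j ≠ 0 := by
  intro hM
  have hij : i ≠ j := by
    rintro rfl
    simp at hM
  obtain ⟨w, hw⟩ := Finite.exists_max cs.length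
  have hlen := length_mul_wordProd_alternatingWord cs hij (cs.not_isRightDescent_one i)
    (cs.not_isRightDescent_one j) (k := cs.length w + 1) (Or.inl hM)
  have hle := hw (1 * cs.wordProd (alternatingWord i j (cs.length w + 1)))
  rw [cs.length_one] at hlen
  omega

theorem length_le_length_longestElement [Finite W] (w : W) :
    cs.length w ≤ cs.length (longestElement cs) :=
  (Finite.exists_max cs.length).choose_spec w

theorem weakLE_longestElement [Finite W] (w : W) : WeakLE cs w (longestElement cs) := by
  obtain ⟨g, -, hg⟩ := exists_weakLE_greatest cs (E := Set.univ) trivial (fun _ _ _ _ => trivial)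
    (fun v _ => length_le_length_longestElement cs v)
    (fun _ i j _ _ _ _ _ => ⟨coxeterMatrix_apply_ne_zero cs i j, trivial⟩)
  rw [(hg (longestElement cs) trivial).eq_of_length_le (length_le_length_longestElement cs g)]
  exact hg w trivial

end ReducedProducts

section BraidMonoid

open CoxeterSystem

variable {B W : Type*} [Group W] {M : CoxeterMatrix B}

/-- The braid relations, as a relation on words in the generators. -/
def braidRel (M : CoxeterMatrix B) (x y : FreeMonoid B) : Prop :=
  ∃ i j, x = FreeMonoid.ofList (braidWord M i j) ∧ y = FreeMonoid.ofList (braidWord M j i)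

/-- The monoid presented by the braid relations. The positive Artin monoid is defined inside the
Artin group instead, and is a quotient of this one; see `equivArtinMonoid` for the converse. -/
abbrev BraidMonoid (M : CoxeterMatrix B) : Type _ := PresentedMonoid (braidRel M)

namespace BraidMonoid

/-- The generators of the braid monoid. -/
def of (M : CoxeterMatrix B) (i : B) : BraidMonoid M := PresentedMonoid.of (braidRel M) i

/-- The common value of both sides of the braid relation between `i` and `j`. -/
def braidElt (M : CoxeterMatrix B) (i j : B) : BraidMonoid M :=
  ((braidWord M i j).map (of M)).prod

theorem mk_ofList (ω : List B) :
    PresentedMonoid.mk (braidRel M) (FreeMonoid.ofList ω) = (ω.map (of M)).prod := by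
  induction ω with
  | nil => rfl
  | cons i ω ih => rw [FreeMonoid.ofList_cons, map_mul, ih, List.map_cons, List.prod_cons]; rfl

theorem braidElt_comm (i j : B) : braidElt M i j = braidElt M j i := by
  rw [braidElt, braidElt, ← mk_ofList, ← mk_ofList]
  exact PresentedMonoid.mk_eq_mk_of_rel ⟨i, j, rfl, rfl⟩

theorem of_dvd_braidElt {i j : B} (hM : M i j ≠ 0) : of M i ∣ braidElt M i j := by
  obtain ⟨ω, hω | hω⟩ := exists_braidWord_eq_cons hM
  · exact ⟨(ω.map (of M)).prod, by rw [braidElt, hω, List.map_cons, List.prod_cons]⟩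
  · exact ⟨(ω.map (of M)).prod, by
      rw [braidElt_comm, braidElt, hω, List.map_cons, List.prod_cons]⟩

@[elab_as_elim]
theorem induction_on {p : BraidMonoid M → Prop} (b : BraidMonoid M) (one : p 1)
    (of_mul : ∀ i b, p b → p (of M i * b)) : p b := by
  obtain ⟨x, rfl⟩ := PresentedMonoid.surjective_mk b
  rw [← FreeMonoid.ofList_toList x]
  induction x.toList with
  | nil => exact one
  | cons i ω ih =>
    rw [FreeMonoid.ofList_cons, map_mul]
    exact of_mul i _ ih

theorem eq_one_or_eq_of_mul (b : BraidMonoid M) : b = 1 ∨ ∃ i c, b = of M i * c := by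
  induction b using induction_on with
  | one => exact .inl rfl
  | of_mul i c _ => exact .inr ⟨i, c, rfl⟩

section Lift

variable {N : Type*} [Monoid N] (f : B → N)

/-- The homomorphism from the braid monoid given by a family of elements that satisfy the braid
relations. -/
def lift (hf : ∀ i j, ((braidWord M i j).map f).prod = ((braidWord M j i).map f).prod) :
    BraidMonoid M →* N :=
  PresentedMonoid.lift f <| by
    rintro _ _ ⟨i, j, rfl, rfl⟩
    simpa only [FreeMonoid.lift_ofList] using hf i j

variable {f} (hf : ∀ i j, ((braidWord M i j).map f).prod = ((braidWord M j i).map f).prod)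

theorem lift_of (i : B) : lift f hf (of M i) = f i := PresentedMonoid.lift_of _ _

end Lift

/-- The degree of an element of the braid monoid: the number of letters of any word that
represents it. -/
def degree (b : BraidMonoid M) : ℕ :=
  (lift (M := M) (fun _ => Multiplicative.ofAdd 1)
    (fun i j => by simp [M.symmetric i j]) b).toAdd

theorem degree_one : degree (1 : BraidMonoid M) = 0 := by simp [degree]

theorem degree_mul (a b : BraidMonoid M) : degree (a * b) = degree a + degree b := by
  simp [degree]

theorem degree_of (i : B) : degree (of M i) = 1 := by simp [degree, lift_of]

theorem degree_of_mul (i : B) (b : BraidMonoid M) : degree (of M i * b) = 1 + degree b := by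
  rw [degree_mul, degree_of]

theorem degree_prod_map_of (ω : List B) : degree (ω.map (of M)).prod = ω.length := by
  induction ω with
  | nil => exact degree_one
  | cons i ω ih =>
    rw [List.map_cons, List.prod_cons, degree_of_mul, ih, List.length_cons, add_comm]

theorem eq_one_of_degree_eq_zero {b : BraidMonoid M} (h : degree b = 0) : b = 1 := by
  obtain rfl | ⟨i, c, rfl⟩ := eq_one_or_eq_of_mul b
  · rfl
  · rw [degree_of_mul] at h
    omega

variable (cs : CoxeterSystem M W)

/-- The projection of the braid monoid onto the Coxeter group. -/
def toCoxeter : BraidMonoid M →* W := lift cs.simple cs.wordProd_braidWord_eq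

theorem toCoxeter_of (i : B) : toCoxeter cs (of M i) = cs.simple i := lift_of _ i

theorem toCoxeter_prod_map_of (ω : List B) :
    toCoxeter cs (ω.map (of M)).prod = cs.wordProd ω := by
  rw [map_list_prod, List.map_map]
  exact congrArg (fun f => (ω.map f).prod) (funext (toCoxeter_of cs))

theorem toCoxeter_braidElt (i j : B) :
    toCoxeter cs (braidElt M i j) = cs.wordProd (braidWord M i j) :=
  toCoxeter_prod_map_of cs _

/-- An element of the braid monoid is reduced if it is represented by a reduced word. -/
def IsReduced (b : BraidMonoid M) : Prop := cs.length (toCoxeter cs b) = degree b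

theorem length_toCoxeter_le (b : BraidMonoid M) : cs.length (toCoxeter cs b) ≤ degree b := by
  induction b using induction_on with
  | one => simp
  | of_mul i b ih =>
    have hle := cs.length_mul_le (cs.simple i) (toCoxeter cs b)
    rw [length_simple] at hle
    rw [map_mul, toCoxeter_of, degree_of_mul]
    omega

theorem isReduced_mul_iff {a b : BraidMonoid M} : IsReduced cs (a * b) ↔
    IsReduced cs a ∧ IsReduced cs b ∧ IsReducedMul cs (toCoxeter cs a) (toCoxeter cs b) := by
  simp only [IsReduced, IsReducedMul, map_mul, degree_mul]
  have ha := length_toCoxeter_le cs a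
  have hb := length_toCoxeter_le cs b
  have hab := cs.length_mul_le (toCoxeter cs a) (toCoxeter cs b)
  omega

theorem isReduced_prod_map_of {ω : List B} (hω : cs.IsReduced ω) :
    IsReduced cs (ω.map (of M)).prod := by
  rw [IsReduced, toCoxeter_prod_map_of, hω, degree_prod_map_of]

theorem isReduced_one : IsReduced cs (1 : BraidMonoid M) := by simp [IsReduced, degree_one]

theorem isReduced_of (i : B) : IsReduced cs (of M i) := by
  rw [IsReduced, toCoxeter_of, length_simple, degree_of]

theorem isReduced_braidElt {i j : B} (hij : i ≠ j) : IsReduced cs (braidElt M i j) :=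
  isReduced_prod_map_of cs (isReduced_braidWord cs hij)

theorem exists_isReduced_toCoxeter_eq (w : W) :
    ∃ b : BraidMonoid M, IsReduced cs b ∧ toCoxeter cs b = w := by
  obtain ⟨ω, hω, rfl⟩ := cs.exists_isReduced w
  exact ⟨_, isReduced_prod_map_of cs hω, toCoxeter_prod_map_of cs ω⟩

theorem IsReduced.isLeftDescent_of_mul {i : B} {b : BraidMonoid M}
    (h : IsReduced cs (of M i * b)) : cs.IsLeftDescent (toCoxeter cs (of M i * b)) i := by
  rw [← isReducedMul_simple_simple_mul_iff, map_mul, toCoxeter_of, simple_mul_simple_cancel_left,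
    ← toCoxeter_of cs]
  exact ((isReduced_mul_iff cs).1 h).2.2

/-- Matsumoto's theorem. -/
theorem toCoxeter_injOn_isReduced :
    Set.InjOn (toCoxeter cs) {b : BraidMonoid M | IsReduced cs b} := by
  intro b hb b' hb' heq
  induction hn : degree b using Nat.strong_induction_on generalizing b b' with
  | _ n ih =>
    have hdeg : degree b' = degree b := by rw [← hb, ← hb', heq]
    have eq_of_common_letter {i : B} {c d : BraidMonoid M} (hc : IsReduced cs (of M i * c))
        (hd : IsReduced cs (of M i * d))
        (hcd : toCoxeter cs (of M i * c) = toCoxeter cs (of M i * d))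
        (hdeg : degree (of M i * c) = n) : of M i * c = of M i * d := by
      rw [map_mul, map_mul] at hcd
      rw [ih (degree c) (by rw [degree_of_mul] at hdeg; omega) ((isReduced_mul_iff cs).1 hc).2.1
        ((isReduced_mul_iff cs).1 hd).2.1 (mul_left_cancel hcd) rfl]
    obtain rfl | ⟨i, c, rfl⟩ := eq_one_or_eq_of_mul b
    · exact (eq_one_of_degree_eq_zero (hdeg.trans degree_one)).symm
    obtain rfl | ⟨j, c', rfl⟩ := eq_one_or_eq_of_mul b'
    · exact eq_one_of_degree_eq_zero (hdeg.symm.trans degree_one)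
    by_cases hij : i = j
    · subst hij
      exact eq_of_common_letter hb hb' heq hn
    obtain ⟨hM, v, hv, hred⟩ := wordProd_braidWord_weakLE_of_isLeftDescent cs hij
      (hb.isLeftDescent_of_mul cs) (heq ▸ hb'.isLeftDescent_of_mul cs)
    obtain ⟨d, hd, rfl⟩ := exists_isReduced_toCoxeter_eq cs v
    rw [← toCoxeter_braidElt] at hv hred
    have hbd : IsReduced cs (braidElt M i j * d) :=
      (isReduced_mul_iff cs).2 ⟨isReduced_braidElt cs hij, hd, hred⟩
    obtain ⟨e, he⟩ := of_dvd_braidElt hM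
    obtain ⟨e', he'⟩ := of_dvd_braidElt (M.symmetric i j ▸ hM : M j i ≠ 0)
    rw [braidElt_comm] at he'
    rw [← map_mul] at hv
    have heq_braidElt_mul : of M i * c = braidElt M i j * d := by
      rw [he, mul_assoc] at hv hbd ⊢
      exact eq_of_common_letter hb hbd hv.symm hn
    have heq_braidElt_mul' : of M j * c' = braidElt M i j * d := by
      rw [he', mul_assoc] at hv hbd ⊢
      exact eq_of_common_letter hb' hbd (heq.symm.trans hv.symm) (hdeg.trans hn)
    exact heq_braidElt_mul.trans heq_braidElt_mul'.symm

/-- The reduced element of the braid monoid that lies over an element of the Coxeter group. -/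
noncomputable def ofCoxeter (w : W) : BraidMonoid M :=
  (exists_isReduced_toCoxeter_eq cs w).choose

theorem isReduced_ofCoxeter (w : W) : IsReduced cs (ofCoxeter cs w) :=
  (exists_isReduced_toCoxeter_eq cs w).choose_spec.1

theorem toCoxeter_ofCoxeter (w : W) : toCoxeter cs (ofCoxeter cs w) = w :=
  (exists_isReduced_toCoxeter_eq cs w).choose_spec.2

theorem IsReduced.ofCoxeter_toCoxeter {b : BraidMonoid M} (hb : IsReduced cs b) :
    ofCoxeter cs (toCoxeter cs b) = b :=
  toCoxeter_injOn_isReduced cs (isReduced_ofCoxeter cs _) hb (toCoxeter_ofCoxeter cs _)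

theorem ofCoxeter_one : ofCoxeter cs 1 = 1 := by
  rw [← map_one (toCoxeter cs), (isReduced_one cs).ofCoxeter_toCoxeter]

theorem ofCoxeter_simple (i : B) : ofCoxeter cs (cs.simple i) = of M i := by
  rw [← toCoxeter_of, (isReduced_of cs i).ofCoxeter_toCoxeter]

theorem ofCoxeter_wordProd_braidWord {i j : B} (hij : i ≠ j) :
    ofCoxeter cs (cs.wordProd (braidWord M i j)) = braidElt M i j := by
  rw [← toCoxeter_braidElt, (isReduced_braidElt cs hij).ofCoxeter_toCoxeter]

theorem ofCoxeter_mul {x y : W} (h : IsReducedMul cs x y) :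
    ofCoxeter cs (x * y) = ofCoxeter cs x * ofCoxeter cs y := by
  have hred : IsReduced cs (ofCoxeter cs x * ofCoxeter cs y) :=
    (isReduced_mul_iff cs).2 ⟨isReduced_ofCoxeter cs x, isReduced_ofCoxeter cs y, by
      rwa [toCoxeter_ofCoxeter, toCoxeter_ofCoxeter]⟩
  rw [← hred.ofCoxeter_toCoxeter, map_mul, toCoxeter_ofCoxeter, toCoxeter_ofCoxeter]

end BraidMonoid

end BraidMonoid

theorem mul_dvd_mul_left_iff {S : Type*} [Monoid S] [IsLeftCancelMul S] {a b c : S} :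
    a * b ∣ a * c ↔ b ∣ c := by
  refine ⟨fun ⟨d, hd⟩ => ⟨d, ?_⟩, mul_dvd_mul_left a⟩
  rw [mul_assoc] at hd
  exact mul_left_cancel hd

section MaxReduced

open CoxeterSystem

variable {B W : Type*} [Group W] {M : CoxeterMatrix B} (cs : CoxeterSystem M W)

/-- The greatest `v` below `w` in the right weak order for which the product `x * v` is
reduced. -/
noncomputable def maxReduced (x w : W) : W := (exists_weakLE_greatest_isReducedMul cs x w).choose

theorem maxReduced_weakLE (x w : W) : WeakLE cs (maxReduced cs x w) w :=
  (exists_weakLE_greatest_isReducedMul cs x w).choose_spec.1.1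

theorem isReducedMul_maxReduced (x w : W) : IsReducedMul cs x (maxReduced cs x w) :=
  (exists_weakLE_greatest_isReducedMul cs x w).choose_spec.1.2

variable {cs}

theorem WeakLE.weakLE_maxReduced {x v w : W} (hvw : WeakLE cs v w) (hxv : IsReducedMul cs x v) :
    WeakLE cs v (maxReduced cs x w) :=
  (exists_weakLE_greatest_isReducedMul cs x w).choose_spec.2 v ⟨hvw, hxv⟩

theorem maxReduced_one (w : W) : maxReduced cs 1 w = w :=
  (maxReduced_weakLE cs 1 w).antisymm
    ((weakLE_refl cs w).weakLE_maxReduced (isReducedMul_one_left cs w))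

theorem IsReducedMul.maxReduced_mul_weakLE {x y : W} (hxy : IsReducedMul cs x y) (w : W) :
    WeakLE cs (maxReduced cs (x * y) w) (maxReduced cs y w) :=
  (maxReduced_weakLE cs (x * y) w).weakLE_maxReduced
    ((isReducedMul_maxReduced cs (x * y) w).right_of_mul hxy)

theorem IsReducedMul.maxReduced_mul_maxReduced {x y : W} (hxy : IsReducedMul cs x y) (w : W) :
    maxReduced cs x (y * maxReduced cs y w) = y * maxReduced cs (x * y) w := by
  set v := maxReduced cs (x * y) w
  have hxyv : IsReducedMul cs (x * y) v := isReducedMul_maxReduced cs (x * y) w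
  have hle : WeakLE cs (y * v) (maxReduced cs x (y * maxReduced cs y w)) :=
    ((isReducedMul_maxReduced cs y w).mul_weakLE_mul (hxy.maxReduced_mul_weakLE w)
      ).weakLE_maxReduced (hxyv.mul_right hxy)
  obtain ⟨b, hb, hyvb⟩ := hle
  have hyv : IsReducedMul cs y v := hxyv.right_of_mul hxy
  have hyb : IsReducedMul cs y (v * b) := hyvb.mul_right hyv
  have hxyb : IsReducedMul cs x (y * (v * b)) := by
    rw [← mul_assoc, hb]
    exact isReducedMul_maxReduced cs x _
  have hvbw : WeakLE cs (v * b) w := by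
    refine (hyb.weakLE_of_mul_weakLE_mul ?_).trans (maxReduced_weakLE cs y w)
    rw [← mul_assoc, hb]
    exact maxReduced_weakLE cs x _
  have hvb : v * b = v := (hvbw.weakLE_maxReduced (hxyb.mul_left hyb)).antisymm
    (hyvb.right_of_mul hyv).weakLE
  rw [← hb, mul_assoc, hvb]

end MaxReduced

namespace BraidMonoid

open CoxeterSystem

variable {B W : Type*} [Group W] {M : CoxeterMatrix B} (cs : CoxeterSystem M W)

section LiftOfReduced

variable {N : Type*} [Monoid N] {f : W → N}

theorem prod_map_simple_of_isReduced (hone : f 1 = 1)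
    (hmul : ∀ x y, IsReducedMul cs x y → f (x * y) = f x * f y) {ω : List B}
    (hω : cs.IsReduced ω) : (ω.map fun i => f (cs.simple i)).prod = f (cs.wordProd ω) := by
  induction ω with
  | nil => rw [wordProd_nil, hone, List.map_nil, List.prod_nil]
  | cons i ω ih =>
    have htail : cs.IsReduced ω := hω.drop 1
    rw [List.map_cons, List.prod_cons, ih htail, wordProd_cons, hmul]
    rw [IsReducedMul, ← wordProd_cons, hω, htail, length_simple, List.length_cons, add_comm]

variable (hone : f 1 = 1) (hmul : ∀ x y, IsReducedMul cs x y → f (x * y) = f x * f y)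

/-- The homomorphism from the braid monoid given by a map on the Coxeter group that is
multiplicative on reduced products. -/
def liftOfReduced : BraidMonoid M →* N :=
  lift (fun i => f (cs.simple i)) fun i j => by
    by_cases hij : i = j
    · rw [hij]
    · rw [prod_map_simple_of_isReduced cs hone hmul (isReduced_braidWord cs hij),
        prod_map_simple_of_isReduced cs hone hmul (isReduced_braidWord cs (Ne.symm hij)),
        wordProd_braidWord_eq]

theorem liftOfReduced_of (i : B) : liftOfReduced cs hone hmul (of M i) = f (cs.simple i) :=
  lift_of _ i

end LiftOfReduced

theorem ofCoxeter_mul_ofCoxeter_inv_mul {v w : W} (h : WeakLE cs v w) :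
    ofCoxeter cs v * ofCoxeter cs (v⁻¹ * w) = ofCoxeter cs w := by
  obtain ⟨a, rfl, ha⟩ := h
  rw [inv_mul_cancel_left, ofCoxeter_mul cs ha]

/-- Left multiplication by the lift of `x`, on pairs `(w, c)` that stand for the products
`ofCoxeter cs w * c`: as much of `w` is merged into `x` as a reduced product allows. -/
noncomputable def headTailAct (x : W) : Function.End (W × BraidMonoid M) := fun P =>
  (x * maxReduced cs x P.1, ofCoxeter cs ((maxReduced cs x P.1)⁻¹ * P.1) * P.2)

theorem headTailAct_one : headTailAct cs 1 = 1 := by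
  funext P
  simp only [headTailAct, maxReduced_one, one_mul, inv_mul_cancel, ofCoxeter_one,
    Function.End.one_def, id]

theorem headTailAct_mul (x y : W) (hxy : IsReducedMul cs x y) :
    headTailAct cs (x * y) = headTailAct cs x * headTailAct cs y := by
  funext ⟨w, c⟩
  change headTailAct cs (x * y) (w, c) = headTailAct cs x (headTailAct cs y (w, c))
  simp only [headTailAct, hxy.maxReduced_mul_maxReduced w, Prod.mk.injEq, mul_assoc, mul_inv_rev,
    inv_mul_cancel_left, true_and]
  obtain ⟨a, ha, hred⟩ := hxy.maxReduced_mul_weakLE w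
  obtain ⟨b, hb, hred'⟩ := maxReduced_weakLE cs y w
  have hab : IsReducedMul cs a b := (ha.symm ▸ hred').right_of_mul hred
  rw [← mul_assoc (ofCoxeter cs _), ← eq_inv_mul_of_mul_eq ha, ← eq_inv_mul_of_mul_eq hb,
    ← ofCoxeter_mul cs hab]
  congr 2
  rw [inv_mul_eq_iff_eq_mul, ← mul_assoc, ha, hb]

/-- The action of the braid monoid by left multiplication on pairs of a head and a tail. -/
noncomputable def headTailHom : BraidMonoid M →* Function.End (W × BraidMonoid M) :=
  liftOfReduced cs (headTailAct_one cs) (headTailAct_mul cs)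

/-- The element with a given head and tail. -/
noncomputable def ofHeadTail (P : W × BraidMonoid M) : BraidMonoid M := ofCoxeter cs P.1 * P.2

theorem headTailHom_of_mul (i : B) (b : BraidMonoid M) (P : W × BraidMonoid M) :
    headTailHom cs (of M i * b) P = headTailAct cs (cs.simple i) (headTailHom cs b P) := by
  rw [map_mul, headTailHom, liftOfReduced_of]
  rfl

theorem ofHeadTail_headTailAct (x : W) (P : W × BraidMonoid M) :
    ofHeadTail cs (headTailAct cs x P) = ofCoxeter cs x * ofHeadTail cs P := by
  rw [ofHeadTail, ofHeadTail, headTailAct, ofCoxeter_mul cs (isReducedMul_maxReduced cs x P.1),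
    mul_assoc, ← mul_assoc (ofCoxeter cs (maxReduced cs x P.1)),
    ofCoxeter_mul_ofCoxeter_inv_mul cs (maxReduced_weakLE cs x P.1)]

theorem ofHeadTail_headTailHom (b : BraidMonoid M) (P : W × BraidMonoid M) :
    ofHeadTail cs (headTailHom cs b P) = b * ofHeadTail cs P := by
  induction b using induction_on with
  | one => rw [map_one, one_mul]; rfl
  | of_mul i b ih =>
    rw [headTailHom_of_mul, ofHeadTail_headTailAct, ih, ofCoxeter_simple, mul_assoc]

theorem ofHeadTail_eq_of_headTailAct_eq {x : W} {P Q : W × BraidMonoid M}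
    (h : headTailAct cs x P = headTailAct cs x Q) : ofHeadTail cs P = ofHeadTail cs Q := by
  rw [headTailAct, headTailAct, Prod.mk.injEq] at h
  have hmax : maxReduced cs x P.1 = maxReduced cs x Q.1 := mul_left_cancel h.1
  rw [ofHeadTail, ofHeadTail, ← ofCoxeter_mul_ofCoxeter_inv_mul cs (maxReduced_weakLE cs x P.1),
    mul_assoc, h.2, ← mul_assoc, hmax,
    ofCoxeter_mul_ofCoxeter_inv_mul cs (maxReduced_weakLE cs x Q.1)]

/-- The head and the tail of an element of the braid monoid. Its left descents are visible as left
descents of the head. -/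
noncomputable def headTail (b : BraidMonoid M) : W × BraidMonoid M := headTailHom cs b (1, 1)

theorem headTail_of_mul (i : B) (b : BraidMonoid M) :
    headTail cs (of M i * b) = headTailAct cs (cs.simple i) (headTail cs b) :=
  headTailHom_of_mul cs i b (1, 1)

theorem ofHeadTail_headTail (b : BraidMonoid M) : ofHeadTail cs (headTail cs b) = b := by
  rw [headTail, ofHeadTail_headTailHom, ofHeadTail, ofCoxeter_one, mul_one, mul_one]

instance : IsLeftCancelMul (BraidMonoid M) where
  mul_left_cancel a b c h := by
    dsimp only at h
    induction a using induction_on with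
    | one => rwa [one_mul, one_mul] at h
    | of_mul i a ih =>
      let cs := M.toCoxeterSystem
      refine ih ?_
      rw [← ofHeadTail_headTail cs (a * b), ← ofHeadTail_headTail cs (a * c)]
      apply ofHeadTail_eq_of_headTailAct_eq cs (x := cs.simple i)
      rw [← headTail_of_mul, ← headTail_of_mul, ← mul_assoc, ← mul_assoc, h]

theorem isLeftDescent_headTail {i : B} {b : BraidMonoid M} (h : of M i ∣ b) :
    cs.IsLeftDescent (headTail cs b).1 i := by
  obtain ⟨c, rfl⟩ := h
  rw [headTail_of_mul, headTailAct, ← isReducedMul_simple_simple_mul_iff,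
    simple_mul_simple_cancel_left]
  exact isReducedMul_maxReduced cs _ _

theorem braidElt_dvd {i j : B} (hij : i ≠ j) {b : BraidMonoid M} (hi : of M i ∣ b)
    (hj : of M j ∣ b) : M i j ≠ 0 ∧ braidElt M i j ∣ b := by
  let cs := M.toCoxeterSystem
  obtain ⟨hM, v, hv, hred⟩ := wordProd_braidWord_weakLE_of_isLeftDescent cs hij
    (isLeftDescent_headTail cs hi) (isLeftDescent_headTail cs hj)
  refine ⟨hM, ofCoxeter cs v * (headTail cs b).2, ?_⟩
  rw [← mul_assoc, ← ofCoxeter_wordProd_braidWord cs hij, ← ofCoxeter_mul cs hred, hv]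
  exact (ofHeadTail_headTail cs b).symm

theorem mul_braidElt_dvd {i j : B} (hij : i ≠ j) {a b : BraidMonoid M} (hi : a * of M i ∣ b)
    (hj : a * of M j ∣ b) : M i j ≠ 0 ∧ a * braidElt M i j ∣ b := by
  obtain ⟨c, rfl⟩ := (dvd_mul_right a _).trans hi
  rw [mul_dvd_mul_left_iff] at *
  exact braidElt_dvd hij hi hj

/-- The steps `d ↦ d * of M i` within the common left divisors of `a` and `b`. -/
def DvdStep (a b d d' : BraidMonoid M) : Prop :=
  (d' ∣ a ∧ d' ∣ b) ∧ ∃ i, d * of M i = d'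

theorem wellFounded_flip_dvdStep (a b : BraidMonoid M) : WellFounded (flip (DvdStep a b)) := by
  refine Subrelation.wf (r := InvImage (· < ·) fun d => degree a - degree d) ?_
    (InvImage.wf _ wellFounded_lt)
  rintro _ d ⟨⟨⟨c, rfl⟩, -⟩, i, rfl⟩
  simp only [InvImage, degree_mul, degree_of]
  omega

open Relation in
theorem reflTransGen_dvdStep_iff {a b d d' : BraidMonoid M} (hd' : d' ∣ a ∧ d' ∣ b) :
    ReflTransGen (DvdStep a b) d d' ↔ d ∣ d' := by
  constructor
  · intro h
    clear hd'
    induction h with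
    | refl => exact dvd_rfl
    | tail _ hstep ih =>
      obtain ⟨-, i, rfl⟩ := hstep
      exact ih.mul_right _
  · rintro ⟨c, rfl⟩
    induction c using induction_on generalizing d with
    | one => rw [mul_one]
    | of_mul i c ih =>
      rw [← mul_assoc] at hd' ⊢
      exact .head ⟨⟨dvd_of_mul_right_dvd hd'.1, dvd_of_mul_right_dvd hd'.2⟩, i, rfl⟩ (ih hd')

open Relation in
theorem exists_dvd_greatest (a b : BraidMonoid M) :
    ∃ g, (g ∣ a ∧ g ∣ b) ∧ ∀ d, d ∣ a → d ∣ b → d ∣ g := by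
  have hconf (d x y : BraidMonoid M) (hx : DvdStep a b d x) (hy : DvdStep a b d y) :
      ∃ u, ReflTransGen (DvdStep a b) x u ∧ ReflTransGen (DvdStep a b) y u := by
    obtain ⟨hia, i, rfl⟩ := hx
    obtain ⟨hja, j, rfl⟩ := hy
    by_cases hij : i = j
    · subst hij
      exact ⟨_, .refl, .refl⟩
    obtain ⟨hM, ha⟩ := mul_braidElt_dvd hij hia.1 hja.1
    have hdvd := And.intro ha (mul_braidElt_dvd hij hia.2 hja.2).2
    refine ⟨_, (reflTransGen_dvdStep_iff hdvd).2 (mul_dvd_mul_left d (of_dvd_braidElt hM)),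
      (reflTransGen_dvdStep_iff hdvd).2 (mul_dvd_mul_left d ?_)⟩
    rw [braidElt_comm]
    exact of_dvd_braidElt (by rwa [M.symmetric])
  obtain ⟨g, hg, hmax⟩ := exists_reflTransGen_greatest (wellFounded_flip_dvdStep a b) hconf 1
  have hgdvd : g ∣ a ∧ g ∣ b := by
    rcases hg.cases_tail with rfl | ⟨_, -, h, -⟩
    exacts [⟨one_dvd a, one_dvd b⟩, h]
  exact ⟨g, hgdvd, fun d hda hdb => (reflTransGen_dvdStep_iff hgdvd).1
    (hmax d ((reflTransGen_dvdStep_iff ⟨hda, hdb⟩).2 (one_dvd d)))⟩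

end BraidMonoid

theorem mul_eq_of_mul_eq_of_mem_center {S : Type*} [Monoid S] [IsLeftCancelMul S] {a b z : S}
    (hz : z ∈ Submonoid.center S) (h : a * b = z) : b * a = z := by
  apply mul_left_cancel (a := a)
  rw [← mul_assoc, h, Submonoid.mem_center_iff.1 hz]

universe u

open OreLocalization in
theorem exists_injective_monoidHom_isUnit_of_mem_center {S : Type u} [Monoid S]
    [IsLeftCancelMul S] {z : S} (hz : z ∈ Submonoid.center S) :
    ∃ (L : Type u) (_ : Monoid L) (φ : S →* L), Function.Injective φ ∧ IsUnit (φ z) := by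
  have hcomm (s : Submonoid.powers z) (a : S) : (s : S) * a = a * s := by
    obtain ⟨_, n, rfl⟩ := s
    exact (Submonoid.mem_center_iff.1 (pow_mem hz n) a).symm
  let : OreSet (Submonoid.powers z) :=
    { ore_right_cancel := fun a b s h => ⟨s, by rw [hcomm, hcomm, h]⟩
      oreNum := fun a _ => a
      oreDenom := fun _ s => s
      ore_eq := fun a s => hcomm s a }
  refine ⟨OreLocalization (Submonoid.powers z) S, inferInstance, numeratorHom, fun a b hab => ?_,
    numerator_isUnit (⟨z, Submonoid.mem_powers z⟩ : Submonoid.powers z)⟩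
  obtain ⟨u, v, huv, hv⟩ := oreDiv_eq_iff.1 hab
  simp only [OneMemClass.coe_one, mul_one] at hv
  subst hv
  exact (mul_left_cancel huv).symm

theorem exists_injective_monoidHom_group {S : Type u} [Monoid S] [IsLeftCancelMul S] {z : S}
    (hz : z ∈ Submonoid.center S) (hgen : Submonoid.closure {a | a ∣ z} = ⊤) :
    ∃ (G : Type u) (_ : Group G) (φ : S →* G), Function.Injective φ := by
  obtain ⟨L, _, φ, hφ, c, hc⟩ := exists_injective_monoidHom_isUnit_of_mem_center hz
  have hdvd : {a | a ∣ z} ⊆ (IsUnit.submonoid L).comap φ := by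
    rintro a ⟨b, hab⟩
    have hba := mul_eq_of_mul_eq_of_mem_center hz hab.symm
    refine isUnit_iff_exists_and_exists.2 ⟨⟨φ b * ↑c⁻¹, ?_⟩, ⟨↑c⁻¹ * φ b, ?_⟩⟩
    · rw [← mul_assoc, ← map_mul, ← hab, ← hc, Units.mul_inv]
    · rw [mul_assoc, ← map_mul, hba, ← hc, Units.inv_mul]
  have hunit (a : S) : IsUnit (φ a) :=
    Submonoid.closure_le.2 hdvd (hgen ▸ Submonoid.mem_top a)
  exact ⟨Lˣ, inferInstance, IsUnit.liftRight φ hunit,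
    fun a b hab => hφ (congrArg Units.val hab)⟩

section ArtinGroup

open CoxeterSystem

variable {B W : Type*} [Group W] {M : CoxeterMatrix B}

namespace ArtinGroup

variable {G : Type*} [Group G] (f : B → G)

/-- The homomorphism from the Artin group given by a family of group elements that satisfy the
braid relations. -/
def lift (hf : ∀ i j, ((braidWord M i j).map f).prod = ((braidWord M j i).map f).prod) :
    ArtinGroup M →* G :=
  PresentedGroup.toGroup (f := f) <| by
    rintro _ ⟨⟨i, j⟩, rfl⟩
    simpa only [braidRelator, map_mul, map_inv, mul_inv_eq_one, map_list_prod, List.map_map,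
      Function.comp_def, FreeGroup.lift_apply_of] using hf i j

variable {f} (hf : ∀ i j, ((braidWord M i j).map f).prod = ((braidWord M j i).map f).prod)

theorem lift_gen (i : B) : lift f hf (gen M i) = f i := PresentedGroup.toGroup.of _

end ArtinGroup

theorem coe_word (ω : List B) : (word M ω : ArtinGroup M) = (ω.map (gen M)).prod := by
  rw [word, ← Submonoid.coe_subtype, map_list_prod, List.map_map]
  rfl

theorem longestElement_inv [Finite W] (cs : CoxeterSystem M W) :
    (longestElement cs)⁻¹ = longestElement cs :=
  (weakLE_longestElement cs _).eq_of_length_le (by rw [cs.length_inv])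

namespace BraidMonoid

/-- The canonical homomorphism from the braid monoid to the positive Artin monoid. -/
def toArtinMonoid (M : CoxeterMatrix B) : BraidMonoid M →* ArtinMonoid M :=
  lift (posGen M) fun i j => Subtype.ext <|
    (coe_word _).trans ((prod_map_braidWord_eq M i j).trans (coe_word _).symm)

theorem toArtinMonoid_of (i : B) : toArtinMonoid M (of M i) = posGen M i := lift_of _ i

theorem toArtinMonoid_prod_map_of (ω : List B) :
    toArtinMonoid M (ω.map (of M)).prod = word M ω := by
  rw [map_list_prod, List.map_map]
  exact congrArg (fun f => (ω.map f).prod) (funext toArtinMonoid_of)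

theorem toArtinMonoid_surjective : Function.Surjective (toArtinMonoid M) := by
  intro w
  obtain ⟨ω, rfl⟩ := word_surjective M w
  exact ⟨_, toArtinMonoid_prod_map_of ω⟩

theorem toArtinMonoid_injective_of_injective {G : Type*} [Group G] {φ : BraidMonoid M →* G}
    (hφ : Function.Injective φ) : Function.Injective (toArtinMonoid M) := by
  have hbraid (i j : B) : ((braidWord M i j).map fun k => φ (of M k)).prod =
      ((braidWord M j i).map fun k => φ (of M k)).prod := by
    have hcomm := congrArg φ (braidElt_comm (M := M) i j)
    simpa only [braidElt, map_list_prod, List.map_map, Function.comp_def] using hcomm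
  have hfactor (b : BraidMonoid M) :
      φ b = ArtinGroup.lift _ hbraid (toArtinMonoid M b : ArtinGroup M) := by
    induction b using induction_on with
    | one => simp only [map_one, OneMemClass.coe_one]
    | of_mul i b ih =>
      rw [map_mul, map_mul, Submonoid.coe_mul, map_mul, ← ih, toArtinMonoid_of]
      exact congrArg (· * φ b) (ArtinGroup.lift_gen hbraid i).symm
  intro a b hab
  exact hφ (by rw [hfactor, hfactor, hab])

section Finite

variable [Finite W] (cs : CoxeterSystem M W)

/-- The Garside element of the braid monoid: the reduced element over the longest element. -/
noncomputable def delta : BraidMonoid M := ofCoxeter cs (longestElement cs)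

theorem ofCoxeter_mul_complement (w : W) :
    ofCoxeter cs w * ofCoxeter cs (w⁻¹ * longestElement cs) = delta cs :=
  ofCoxeter_mul_ofCoxeter_inv_mul cs (weakLE_longestElement cs w)

theorem ofCoxeter_mul_delta (w : W) : ofCoxeter cs w * delta cs =
    delta cs * ofCoxeter cs ((longestElement cs)⁻¹ * w * longestElement cs) := by
  have hconj : (longestElement cs)⁻¹ * w * longestElement cs =
      (w⁻¹ * longestElement cs)⁻¹ * longestElement cs := by group
  rw [hconj, ← ofCoxeter_mul_complement cs w, mul_assoc, ofCoxeter_mul_complement cs,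
    ofCoxeter_mul_complement cs]

theorem exists_mul_delta_eq (b : BraidMonoid M) : ∃ b', b * delta cs = delta cs * b' := by
  induction b using induction_on with
  | one => exact ⟨1, by rw [one_mul, mul_one]⟩
  | of_mul i b ih =>
    obtain ⟨b', hb'⟩ := ih
    exact ⟨_, by rw [mul_assoc, hb', ← mul_assoc, ← ofCoxeter_simple cs, ofCoxeter_mul_delta,
      mul_assoc]⟩

theorem ofCoxeter_mul_delta_sq (w : W) :
    ofCoxeter cs w * delta cs ^ 2 = delta cs ^ 2 * ofCoxeter cs w := by
  have hconj : (longestElement cs)⁻¹ * ((longestElement cs)⁻¹ * w * longestElement cs) *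
      longestElement cs = w := by
    simp only [longestElement_inv, mul_assoc]
    nth_rw 1 [← longestElement_inv]
    nth_rw 4 [← longestElement_inv]
    rw [mul_inv_cancel, mul_one, inv_mul_cancel_left]
  rw [pow_two, ← mul_assoc, ofCoxeter_mul_delta, mul_assoc, ofCoxeter_mul_delta, hconj, mul_assoc]

theorem delta_sq_mem_center : delta cs ^ 2 ∈ Submonoid.center (BraidMonoid M) := by
  refine Submonoid.mem_center_iff.2 fun b => ?_
  induction b using induction_on with
  | one => rw [one_mul, mul_one]
  | of_mul i b ih =>
    rw [mul_assoc, ih, ← mul_assoc, ← ofCoxeter_simple cs, ofCoxeter_mul_delta_sq, mul_assoc]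

theorem of_dvd_delta (i : B) : of M i ∣ delta cs :=
  ⟨_, by rw [← ofCoxeter_simple cs, ofCoxeter_mul_complement]⟩

include cs in
theorem toArtinMonoid_injective : Function.Injective (toArtinMonoid M) := by
  have hgen : Submonoid.closure {a : BraidMonoid M | a ∣ delta cs ^ 2} = ⊤ := by
    refine (Submonoid.eq_top_iff' _).2 fun b => ?_
    induction b using induction_on with
    | one => exact one_mem _
    | of_mul i b ih =>
      exact mul_mem (Submonoid.subset_closure (dvd_pow (of_dvd_delta cs i) two_ne_zero)) ih
  obtain ⟨G, _, φ, hφ⟩ := exists_injective_monoidHom_group (delta_sq_mem_center cs) hgen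
  exact toArtinMonoid_injective_of_injective hφ

/-- The braid monoid of a finite Coxeter system is the positive Artin monoid. -/
noncomputable def equivArtinMonoid : BraidMonoid M ≃* ArtinMonoid M :=
  .ofBijective (toArtinMonoid M) ⟨toArtinMonoid_injective cs, toArtinMonoid_surjective⟩

end Finite

end BraidMonoid

open BraidMonoid in
theorem word_eq_posLift (cs : CoxeterSystem M W) {ω : List B} (hω : cs.IsReduced ω) :
    word M ω = posLift cs (cs.wordProd ω) := by
  obtain ⟨hred, heq⟩ := (cs.exists_isReduced (cs.wordProd ω)).choose_spec
  rw [posLift, ← toArtinMonoid_prod_map_of, ← toArtinMonoid_prod_map_of]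
  congr 1
  refine toCoxeter_injOn_isReduced cs (isReduced_prod_map_of cs hω)
    (isReduced_prod_map_of cs hred) ?_
  rw [toCoxeter_prod_map_of, toCoxeter_prod_map_of, ← heq]

theorem BraidMonoid.toArtinMonoid_ofCoxeter (cs : CoxeterSystem M W) (w : W) :
    toArtinMonoid M (ofCoxeter cs w) = posLift cs w := by
  obtain ⟨ω, hω, rfl⟩ := cs.exists_isReduced w
  rw [← word_eq_posLift cs hω, ← toArtinMonoid_prod_map_of, ← toCoxeter_prod_map_of,
    (isReduced_prod_map_of cs hω).ofCoxeter_toCoxeter]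

end ArtinGroup

section ArtinMonoid

open CoxeterSystem

variable {B W : Type*} [Group W] {M : CoxeterMatrix B} {u w : ArtinMonoid M}

/-- The homomorphism from the Artin group to `ℤ` that sends every generator to `1`. On the positive
Artin monoid it is the length, which is therefore additive. -/
def lengthHom (M : CoxeterMatrix B) : ArtinGroup M →* Multiplicative ℤ :=
  ArtinGroup.lift (fun _ => .ofAdd 1) fun i j => by
    rw [List.map_const', List.map_const', length_alternatingWord, length_alternatingWord,
      M.symmetric]

theorem lengthHom_word (ω : List B) :
    lengthHom M (word M ω : ArtinGroup M) = .ofAdd (ω.length : ℤ) := by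
  have hgen : lengthHom M ∘ gen M = fun _ => .ofAdd 1 := funext (ArtinGroup.lift_gen _)
  rw [coe_word, map_list_prod, List.map_map, hgen, List.map_const', List.prod_replicate,
    ← ofAdd_nsmul, nsmul_one]

theorem length_word (ω : List B) : length (word M ω) = ω.length := by
  obtain ⟨ω', hlen, hω'⟩ := exists_word_length_eq (word M ω)
  have h := lengthHom_word (M := M) ω'
  rw [hω', lengthHom_word] at h
  exact hlen ▸ (Int.ofNat_inj.1 (Multiplicative.ofAdd.injective h)).symm

theorem length_mul (u v : ArtinMonoid M) : length (u * v) = length u + length v := by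
  obtain ⟨ω, rfl⟩ := word_surjective M u
  obtain ⟨ω', rfl⟩ := word_surjective M v
  rw [← word_append, length_word, length_word, length_word, List.length_append]

theorem length_pow (u : ArtinMonoid M) (m : ℕ) : length (u ^ m) = m * length u := by
  induction m with
  | zero => rw [pow_zero, length_one, zero_mul]
  | succ m ih => rw [pow_succ, length_mul, ih, add_mul, one_mul]

theorem length_posGen (i : B) : length (posGen M i) = 1 := by
  rw [← List.prod_singleton (x := posGen M i)]
  exact length_word [i]

theorem exists_eq_posGen_mul (hw : w ≠ 1) : ∃ i v, w = posGen M i * v := by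
  obtain ⟨_ | ⟨i, ω⟩, rfl⟩ := word_surjective M w
  · exact absurd (word_nil M) hw
  · exact ⟨i, word M ω, List.prod_cons⟩

theorem le_iff_dvd : u ≤ w ↔ u ∣ w :=
  ⟨fun ⟨v, h, _⟩ => ⟨v, h.symm⟩, fun ⟨v, h⟩ => ⟨v, h.symm, by rw [h, length_mul]⟩⟩

theorem one_le (w : ArtinMonoid M) : 1 ≤ w := le_iff_dvd.2 (one_dvd w)

theorem length_mono : Monotone (length (M := M)) := by
  rintro u _ ⟨v, -, h⟩
  exact h ▸ Nat.le_add_right _ _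

theorem length_strictMono : StrictMono (length (M := M)) := by
  intro u w huw
  obtain ⟨v, rfl, h⟩ := huw.le
  have hv : length v ≠ 0 := fun hv => huw.ne (by rw [eq_one_of_length_eq_zero hv, mul_one])
  lia

theorem finite_Iic [Finite B] (w : ArtinMonoid M) : (Set.Iic w).Finite := by
  refine ((List.finite_length_le B (length w)).image (word M)).subset fun u hu => ?_
  obtain ⟨ω, rfl⟩ := word_surjective M u
  exact ⟨ω, (length_word ω).symm.trans_le (length_mono hu), rfl⟩

theorem exists_eq_mul_posGen_of_covBy (h : u ⋖ w) : ∃ i, w = u * posGen M i := by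
  obtain ⟨v, rfl⟩ := le_iff_dvd.1 h.le
  obtain ⟨i, v, rfl⟩ := exists_eq_posGen_mul fun hv : v = 1 => h.ne (by rw [hv, mul_one])
  have hle : u * posGen M i ≤ u * (posGen M i * v) := le_iff_dvd.2 ⟨v, (mul_assoc _ _ _).symm⟩
  have hne : u * posGen M i ≠ u := fun heq => by
    have := congrArg length heq
    rw [length_mul, length_posGen] at this
    lia
  exact ⟨i, ((h.wcovBy.eq_or_eq (le_iff_dvd.2 ⟨_, rfl⟩) hle).resolve_left hne).symm⟩

noncomputable instance : GradeMinOrder ℕ (ArtinMonoid M) where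
  grade := length
  grade_strictMono := length_strictMono
  covBy_grade u w h := by
    obtain ⟨i, rfl⟩ := exists_eq_mul_posGen_of_covBy h
    rw [length_mul, length_posGen]
    exact Order.covBy_add_one _
  isMin_grade w hw := by
    rw [hw.eq_of_ge (one_le w), length_one]
    exact isMin_bot

/-- The grading of an interval `[1, w]` of the weak order by length. -/
noncomputable abbrev gradeMinOrderIcc (w : ArtinMonoid M) : GradeMinOrder ℕ (Set.Icc 1 w) :=
  .liftRight Subtype.val (Subtype.strictMono_coe _)
    (fun _ _ h => (Set.OrdConnected.apply_covBy_apply_iff (OrderEmbedding.subtype _) <| by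
      simpa only [OrderEmbedding.coe_subtype, Subtype.range_coe] using Set.ordConnected_Icc).2 h)
    fun u hu => by
      have hu1 : u ≤ ⟨1, le_rfl, one_le w⟩ := hu (show _ ≤ u from u.2.1)
      exact fun v _ => (show (u : ArtinMonoid M) ≤ 1 from hu1).trans (one_le v)

theorem rev_one : rev (1 : ArtinMonoid M) = 1 := rev_word M []

theorem rev_mul (u v : ArtinMonoid M) : rev (u * v) = rev v * rev u := by
  obtain ⟨ω, rfl⟩ := word_surjective M u
  obtain ⟨ω', rfl⟩ := word_surjective M v
  rw [← word_append, rev_word, rev_word, rev_word, List.reverse_append, word_append]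

theorem rev_rev (u : ArtinMonoid M) : rev (rev u) = u := by
  obtain ⟨ω, rfl⟩ := word_surjective M u
  rw [rev_word, rev_word, List.reverse_reverse]

theorem length_rev (u : ArtinMonoid M) : length (rev u) = length u := by
  obtain ⟨ω, rfl⟩ := word_surjective M u
  rw [rev_word, length_word, length_word, List.length_reverse]

theorem length_posLift (cs : CoxeterSystem M W) (v : W) : length (posLift cs v) = cs.length v := by
  obtain ⟨ω, hω, rfl⟩ := cs.exists_isReduced v
  rw [← word_eq_posLift cs hω, length_word, hω]

theorem rev_posLift (cs : CoxeterSystem M W) (v : W) : rev (posLift cs v) = posLift cs v⁻¹ := by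
  obtain ⟨ω, hω, rfl⟩ := cs.exists_isReduced v
  rw [← word_eq_posLift cs hω, rev_word, word_eq_posLift cs hω.reverse, cs.wordProd_reverse]

theorem length_fundamental_pow [Finite W] (cs : CoxeterSystem M W) (m : ℕ) :
    length (fundamental cs ^ m) = m * cs.length (longestElement cs) := by
  rw [length_pow, fundamental, length_posLift]

open BraidMonoid in
theorem exists_isGLB [Finite W] (cs : CoxeterSystem M W) (u w : ArtinMonoid M) :
    ∃ g, IsGLB {u, w} g := by
  have hdvd (a b : BraidMonoid M) :
      equivArtinMonoid cs a ≤ equivArtinMonoid cs b ↔ a ∣ b :=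
    le_iff_dvd.trans (map_dvd_iff (equivArtinMonoid cs))
  obtain ⟨a, rfl⟩ := (equivArtinMonoid cs).surjective u
  obtain ⟨b, rfl⟩ := (equivArtinMonoid cs).surjective w
  obtain ⟨g, hg, hgreatest⟩ := exists_dvd_greatest a b
  refine ⟨equivArtinMonoid cs g, ?_, fun d hd => ?_⟩
  · simpa only [lowerBounds_insert, lowerBounds_singleton, Set.mem_inter_iff, Set.mem_Iic, hdvd]
      using hg
  · obtain ⟨d, rfl⟩ := (equivArtinMonoid cs).surjective d
    simp only [lowerBounds_insert, lowerBounds_singleton, Set.mem_inter_iff, Set.mem_Iic,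
      hdvd] at hd ⊢
    exact hgreatest d hd.1 hd.2

end ArtinMonoid

section Duality

variable {B W : Type*} [Group W] {M : CoxeterMatrix B}

/-- An element `D` of the positive Artin monoid that is a palindrome and satisfies `B⁺ D ⊆ D B⁺`.
This is what makes `w ↦ rev (D w⁻¹)` a duality of the interval `[1, D]`. -/
structure IsDualizing (D : ArtinMonoid M) : Prop where
  rev_eq : rev D = D
  exists_mul_eq (b : ArtinMonoid M) : ∃ b', b * D = D * b'

namespace IsDualizing

variable {D : ArtinMonoid M}

theorem pow (hD : IsDualizing D) (m : ℕ) : IsDualizing (D ^ m) := by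
  induction m with
  | zero => exact ⟨by rw [pow_zero, rev_one], fun b => ⟨b, by rw [pow_zero, mul_one, one_mul]⟩⟩
  | succ m ih =>
    refine ⟨by rw [pow_succ, rev_mul, hD.rev_eq, ih.rev_eq, ← pow_succ', pow_succ], fun b => ?_⟩
    obtain ⟨b₁, h₁⟩ := ih.exists_mul_eq b
    obtain ⟨b₂, h₂⟩ := hD.exists_mul_eq b₁
    exact ⟨b₂, by rw [pow_succ, ← mul_assoc, h₁, mul_assoc, h₂, mul_assoc]⟩

variable (hD : IsDualizing D) (w w' : Set.Icc 1 D)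

include hD

theorem exists_eq_mul (b : ArtinMonoid M) : ∃ b', D * b = b' * D := by
  obtain ⟨c, hc⟩ := hD.exists_mul_eq (rev b)
  refine ⟨rev c, ?_⟩
  simpa only [rev_mul, rev_rev, hD.rev_eq] using congrArg rev hc

theorem dvd_of_mul_eq {u v : ArtinMonoid M} (h : u * v = D) : v ∣ D := by
  obtain ⟨b, hb⟩ := hD.exists_mul_eq u
  exact ⟨b, mul_left_cancel (a := u) (by rw [hb, ← mul_assoc, h])⟩

theorem mul_inv_mem_positiveSubmonoid :
    (D : ArtinGroup M) * ((w : ArtinMonoid M) : ArtinGroup M)⁻¹ ∈ positiveSubmonoid M := by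
  obtain ⟨v, hv⟩ := le_iff_dvd.1 w.2.2
  obtain ⟨b, hb⟩ := hD.exists_eq_mul v
  have hbw : b * w = D := mul_right_cancel (b := v) (by rw [mul_assoc, ← hv, hb])
  rw [← eq_mul_inv_of_mul_eq (congrArg Subtype.val hbw)]
  exact b.2

/-- The positive element `D w⁻¹` of the Artin group. -/
def complement : ArtinMonoid M :=
  ⟨D * ((w : ArtinMonoid M) : ArtinGroup M)⁻¹, hD.mul_inv_mem_positiveSubmonoid w⟩

theorem complement_mul : hD.complement w * w = D := Subtype.ext (inv_mul_cancel_right _ _)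

theorem rev_mul_rev_complement : rev (w : ArtinMonoid M) * rev (hD.complement w) = D := by
  rw [← rev_mul, hD.complement_mul, hD.rev_eq]

/-- The duality `w ↦ rev (D w⁻¹)` of the interval `[1, D]`. -/
def dual : Set.Icc 1 D :=
  ⟨rev (hD.complement w), one_le _,
    le_iff_dvd.2 (hD.dvd_of_mul_eq (hD.rev_mul_rev_complement w))⟩

theorem coe_dual : (hD.dual w : ArtinMonoid M) = rev (hD.complement w) := rfl

theorem dual_involutive : Function.Involutive hD.dual := fun w => by
  have hcomplement : hD.complement (hD.dual w) = rev w :=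
    mul_right_cancel ((hD.complement_mul _).trans (hD.rev_mul_rev_complement w).symm)
  exact Subtype.ext (by rw [coe_dual, hcomplement, rev_rev])

theorem length_dual_add : length (hD.dual w : ArtinMonoid M) + length (w : ArtinMonoid M) =
    length D := by
  rw [coe_dual, length_rev, ← length_mul, hD.complement_mul]

variable {w w'} in
theorem dual_le_dual (h : w ≤ w') : hD.dual w' ≤ hD.dual w := by
  obtain ⟨v, hv⟩ := le_iff_dvd.1 (show (w : ArtinMonoid M) ≤ w' from h)
  obtain ⟨b, hb⟩ := hD.exists_eq_mul v
  have hcomplement : b * hD.complement w' = hD.complement w := by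
    apply mul_right_cancel (b := (w' : ArtinMonoid M))
    rw [mul_assoc, hD.complement_mul, ← hb, hv, ← mul_assoc, hD.complement_mul]
  refine le_iff_dvd.2 ⟨rev b, ?_⟩
  rw [coe_dual, coe_dual, ← hcomplement, rev_mul]

/-- The duality as an isomorphism of the interval `[1, D]` with its order dual. -/
def dualOrderIso : Set.Icc 1 D ≃o (Set.Icc 1 D)ᵒᵈ where
  toEquiv := hD.dual_involutive.toPerm.trans OrderDual.toDual
  map_rel_iff' {w w'} :=
    ⟨fun h => hD.dual_involutive w ▸ hD.dual_involutive w' ▸ hD.dual_le_dual h, hD.dual_le_dual⟩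

theorem card_length_eq {k l : ℕ} (hkl : k + l = length D) :
    Nat.card {w : Set.Icc 1 D // length (w : ArtinMonoid M) = k} =
      Nat.card {w : Set.Icc 1 D // length (w : ArtinMonoid M) = l} := by
  refine Nat.card_congr (hD.dual_involutive.toPerm.subtypeEquiv fun w => ?_)
  have hlen := hD.length_dual_add w
  rw [Function.Involutive.coe_toPerm]
  lia

end IsDualizing

variable [Finite W] (cs : CoxeterSystem M W)

open BraidMonoid in
theorem isDualizing_fundamental : IsDualizing (fundamental cs) where
  rev_eq := by rw [fundamental, rev_posLift, longestElement_inv]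
  exists_mul_eq b := by
    obtain ⟨b, rfl⟩ := toArtinMonoid_surjective b
    obtain ⟨b', hb'⟩ := exists_mul_delta_eq cs b
    refine ⟨toArtinMonoid M b', ?_⟩
    rw [fundamental, ← toArtinMonoid_ofCoxeter, ← map_mul, ← map_mul]
    exact congrArg _ hb'

include cs

theorem exists_isGLB_Icc {D : ArtinMonoid M} (u v : Set.Icc 1 D) : ∃ y, IsGLB {u, v} y := by
  obtain ⟨g, hg, hgreatest⟩ := exists_isGLB cs (u : ArtinMonoid M) v
  rw [lowerBounds_insert, lowerBounds_singleton] at hg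
  refine ⟨⟨g, one_le g, hg.1.trans u.2.2⟩, ?_, fun x hx => hgreatest ?_⟩
  · rwa [lowerBounds_insert, lowerBounds_singleton]
  · rw [lowerBounds_insert, lowerBounds_singleton] at hx ⊢
    exact hx

theorem exists_isLUB_Icc {D : ArtinMonoid M} (hD : IsDualizing D) (u v : Set.Icc 1 D) :
    ∃ x, IsLUB {u, v} x := by
  obtain ⟨y, hy⟩ := exists_isGLB_Icc cs (hD.dual u) (hD.dual v)
  refine ⟨hD.dualOrderIso.symm (OrderDual.toDual y), hD.dualOrderIso.isLUB_image.1 ?_⟩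
  rw [Set.image_pair]
  exact hy.dual

theorem finite_Icc (u v : ArtinMonoid M) : Finite (Set.Icc u v) := by
  have := Finite.of_injective cs.simple (simple_injective cs)
  exact ((finite_Iic v).subset Set.Icc_subset_Iic_self).to_subtype

end Duality

end Artin

theorem mainTheorem9 {B W : Type*} [Group W] [Finite W] {M : CoxeterMatrix B}
    (cs : CoxeterSystem M W) (m : ℕ) :
    -- the `m`-weak order is a finite lattice
    Finite (Artin.MWeak cs m) ∧
    (∀ u v : Artin.MWeak cs m, (∃ x, IsLUB {u, v} x) ∧ (∃ y, IsGLB {u, v} y)) ∧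
    -- it is graded by length, of total rank `m * ℓ(w∘)`
    (∃ g : GradeMinOrder ℕ (Artin.MWeak cs m),
      ∀ w : Artin.MWeak cs m, g.grade w = Artin.length (w : Artin.ArtinMonoid M)) ∧
    Artin.length (Artin.fundamental cs ^ m) = m * cs.length (Artin.longestElement cs) ∧
    -- it is rank-symmetric
    (∀ k l : ℕ, k + l = m * cs.length (Artin.longestElement cs) →
      Nat.card {w : Artin.MWeak cs m // Artin.length (w : Artin.ArtinMonoid M) = k} =
        Nat.card {w : Artin.MWeak cs m // Artin.length (w : Artin.ArtinMonoid M) = l}) ∧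
    -- it is self-dual via `w ↦ rev (w∘ ^ m * w⁻¹)`, where `w∘ ^ m * w⁻¹` is a positive element
    (∃ e : Artin.MWeak cs m ≃o (Artin.MWeak cs m)ᵒᵈ, ∀ w : Artin.MWeak cs m,
      ∃ u : Artin.ArtinMonoid M,
        (u : Artin.ArtinGroup M) =
          (Artin.fundamental cs : Artin.ArtinGroup M) ^ m *
            ((w : Artin.ArtinMonoid M) : Artin.ArtinGroup M)⁻¹ ∧
        ((OrderDual.ofDual (e w) : Artin.MWeak cs m) : Artin.ArtinMonoid M) = Artin.rev u) := by
  have hD := (Artin.isDualizing_fundamental cs).pow m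
  have hlen := Artin.length_fundamental_pow cs m
  exact ⟨Artin.finite_Icc cs _ _,
    fun u v => ⟨Artin.exists_isLUB_Icc cs hD u v, Artin.exists_isGLB_Icc cs u v⟩,
    ⟨Artin.gradeMinOrderIcc _, fun _ => rfl⟩,
    hlen,
    fun k l hkl => hD.card_length_eq (hkl.trans hlen.symm),
    hD.dualOrderIso, fun w => ⟨hD.complement w, rfl, rfl⟩⟩
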